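/- Let $A$ be a simple, separable, unital $C^*$-algebra whose decomposition rank is a finite number $n$. Let $T(A)$ be the set of tracial states of $A$ (positive linear functionals $\tau$ on $A$ with $\tau(1_A)=1$ and $\tau(xy)=\tau(yx)$ for all $x,y\in A$), and for $\tau\in T(A)$ and a positive element $b\in A_+$ put $d_\tau(b)=\lim_{k\to\infty}\tau(b^{1/k})$. If $a,d^{(0)},\dots,d^{(n)}\in A_+$ satisfy $$d_\tau(a)<d_\tau(d^{(i)})\qquad\text{for every } i\in\{0,\dots,n\} \text{ and every } \tau\in T(A),$$ then $$\langle a\rangle\le\langle d^{(0)}\rangle+\dots+\langle d^{(n)}\rangle$$ in the Cuntz semigroup $W(A)$. Here $W(A)=M_\infty(A)_+/\!\sim$, where $M_\infty(A)=\bigcup_m M_m(A)$ along the upper left corner inclusions; $a\precsim b$ means that there is a sequence $(v_k)$ in $M_\infty(A)$ with $\|v_kbv_k^*-a\|\to0$; $a\sim b$ means $a\precsim b$ and $b\precsim a$; $\langle a\rangle$ is the class of $a$; and $W(A)$ carries the addition $\langle a\rangle+\langle b\rangle=\langle a\oplus b\rangle$ and the order $\langle a\rangle\le\langle b\rangle\Leftrightarrow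 a\precsim b$. The decomposition rank of $A$ is the least integer $n\ge 0$ (and $\infty$ if there is none) such that for all finite sets $\{b_1,\dots,b_m\}\subset A$ and all $\varepsilon>0$ there are a finite-dimensional $C^*$-algebra $F=\bigoplus_{i=1}^sM_{r_i}(\mathbb C)$ and completely positive contractions $\psi:A\to F$, $\varphi:F\to A$ with $\|\varphi\psi(b_j)-b_j\|<\varepsilon$ for all $j$, such that $\{1,\dots,s\}$ is a disjoint union of (possibly empty) sets $I_0,\dots,I_n$ for which each restriction of $\varphi$ to $\bigoplus_{i\in I_j}M_{r_i}(\mathbb C)$ preserves orthogonality, i.e. $\varphi(x)\varphi(y)=0$ for all positive $x,y$ in it with $xy=0$. -/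

import Mathlib

open Filter Topology
open scoped ComplexOrder CStarAlgebra

/-! ## Simple C*-algebras and tracial states -/

/-- A unital C*-algebra is simple if it is nonzero and its only closed two-sided ideals are
the trivial ones. -/
def IsSimpleCStarAlgebra (A : Type*) [CStarAlgebra A] : Prop :=
  Nontrivial A ∧ ∀ I : TwoSidedIdeal A, IsClosed (I : Set A) → I = ⊥ ∨ I = ⊤

/-- The tracial states of a unital C*-algebra: positive linear functionals `τ` with `τ 1 = 1` and
`τ (x * y) = τ (y * x)`. -/
structure TracialState (A : Type*) [CStarAlgebra A] [PartialOrder A] [StarOrderedRing A]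
    extends A →ₚ[ℂ] ℂ where
  map_one' : toFun 1 = 1
  map_mul_comm' : ∀ x y : A, toFun (x * y) = toFun (y * x)

/-- The dimension function `d_τ(a) = lim_{n → ∞} τ(a^{1/n})` of a positive element `a`
(the limit exists, see `TracialState.tendsto_dimFun`). -/
noncomputable def TracialState.dimFun {A : Type*} [CStarAlgebra A] [PartialOrder A]
    [StarOrderedRing A] (τ : TracialState A) (a : A) : ℝ :=
  limUnder atTop (fun n : ℕ => (τ.toPositiveLinearMap (a ^ (1 / (n : ℝ)))).re)

/-- The limit that defines `d_τ(a)` exists. -/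
theorem TracialState.tendsto_dimFun {A : Type*} [CStarAlgebra A] [PartialOrder A]
    [StarOrderedRing A] (τ : TracialState A) (a : A) :
    Tendsto (fun n : ℕ => (τ.toPositiveLinearMap (a ^ (1 / (n : ℝ)))).re) atTop
      (𝓝 (τ.dimFun a)) := by
  apply tendsto_nhds_limUnder
  have hA : Nontrivial A := by
    by_contra h
    rw [not_nontrivial_iff_subsingleton] at h
    have h1 := τ.map_one'
    have h2 : τ.toFun 0 = 0 := map_zero τ.toPositiveLinearMap
    rw [Subsingleton.elim (1 : A) 0, h2] at h1
    exact zero_ne_one h1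
  set f := τ.toPositiveLinearMap with hf
  set c : NNReal := max 1 ‖a‖₊ with hc
  have hc1 : 1 ≤ c := le_max_left _ _
  have hc0 : c ≠ 0 := (zero_lt_one.trans_le hc1).ne'
  have hspec : ∀ x ∈ spectrum NNReal a, x / c ≤ 1 := by
    intro x hx
    refine div_le_one_of_le₀ (le_trans ?_ (le_max_right _ _)) zero_le
    exact spectrum.le_nnnorm_of_mem hx
  have hcont : ∀ n : ℕ, ContinuousOn (fun x : NNReal => (x / c) ^ (1 / ((n : ℝ) + 1)))
      (spectrum NNReal a) := by
    intro n
    refine Continuous.continuousOn ?_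
    exact (NNReal.continuous_rpow_const (by positivity)).comp (by fun_prop)
  let g : ℕ → A := fun n => cfc (fun x : NNReal => (x / c) ^ (1 / ((n : ℝ) + 1))) a
  have hpow : ∀ n : ℕ, a ^ (1 / ((n : ℝ) + 1)) = (c ^ (1 / ((n : ℝ) + 1))) • g n := by
    intro n
    simp only [g]
    rw [← cfc_smul _ _ a (hcont n), CFC.rpow_def]
    refine cfc_congr fun x _ => ?_
    simp only [smul_eq_mul]
    rw [← NNReal.mul_rpow, mul_div_cancel₀ _ hc0]
  have hmono : Monotone g := by
    intro n k hnk
    refine cfc_mono (fun x hx => ?_) (hcont n) (hcont k)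
    rcases eq_or_ne (x / c) 0 with h0 | h0
    · rw [h0, NNReal.zero_rpow (by positivity)]
      exact zero_le
    · refine NNReal.rpow_le_rpow_of_exponent_ge (pos_iff_ne_zero.2 h0) (hspec x hx) ?_
      gcongr
  have hle : ∀ n, g n ≤ 1 := by
    intro n
    refine cfc_le_one _ _ fun x hx => ?_
    exact NNReal.rpow_le_one (hspec x hx) (by positivity)
  have hfm : Monotone fun n => (f (g n)).re := fun n k hnk =>
    (Complex.le_def.1 (OrderHomClass.mono f (hmono hnk))).1
  have hbdd : BddAbove (Set.range fun n => (f (g n)).re) := by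
    refine ⟨(f 1).re, ?_⟩
    rintro _ ⟨n, rfl⟩
    exact (Complex.le_def.1 (OrderHomClass.mono f (hle n))).1
  have hlim := tendsto_atTop_ciSup hfm hbdd
  have hclim : Tendsto (fun n : ℕ => (c : ℝ) ^ (1 / ((n : ℝ) + 1))) atTop (𝓝 1) := by
    have h := tendsto_one_div_add_atTop_nhds_zero_nat (𝕜 := ℝ)
    have h2 := (Real.continuous_const_rpow (a := (c : ℝ)) (by exact_mod_cast hc0)).tendsto 0
    rw [Real.rpow_zero] at h2
    exact h2.comp h
  refine ⟨_, (tendsto_add_atTop_iff_nat 1).1 ((hclim.mul hlim).congr fun n => ?_)⟩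
  rw [Nat.cast_add, Nat.cast_one, hpow n, NNReal.smul_def, NNReal.coe_rpow, ← Complex.coe_smul,
    map_smul]
  simp

/-! ## Decomposition rank -/

/-- The finite-dimensional C*-algebra `M_{r_1} ⊕ ⋯ ⊕ M_{r_s}`. -/
abbrev MatrixSum {s : ℕ} (r : Fin s → ℕ) : Type :=
  ∀ i : Fin s, CStarMatrix (Fin (r i)) (Fin (r i)) ℂ

/-- A completely positive map `φ` on `M_{r_1} ⊕ ⋯ ⊕ M_{r_s}` is `n`-decomposable if the summands can
be coloured by the `n + 1` colours `0, …, n` (the colour classes are the sets `I_j`) in such a way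
that the restriction of `φ` to the sum of the summands of each colour preserves orthogonality
of positive elements. -/
def IsDecomposable {A : Type*} [CStarAlgebra A] [PartialOrder A] [StarOrderedRing A]
    {s : ℕ} {r : Fin s → ℕ} (φ : MatrixSum r →CP A) (n : ℕ) : Prop :=
  ∃ c : Fin s → Fin (n + 1), ∀ (j : Fin (n + 1)) (x y : MatrixSum r),
    (∀ i, c i ≠ j → x i = 0) → (∀ i, c i ≠ j → y i = 0) →
    0 ≤ x → 0 ≤ y → x * y = 0 → φ x * φ y = 0

/-- The approximation property in the definition of the decomposition rank: every finite set of
elements of `A` is approximated, within any `ε > 0`, by a pair of completely positive contractions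
`A → F → A` through a finite-dimensional C*-algebra `F`, the second of which is
`n`-decomposable. -/
def HasDecomposableApprox (A : Type*) [CStarAlgebra A] [PartialOrder A] [StarOrderedRing A]
    (n : ℕ) : Prop :=
  ∀ (b : Finset A) (ε : ℝ), 0 < ε →
    ∃ (s : ℕ) (r : Fin s → ℕ) (ψ : A →CP MatrixSum r) (φ : MatrixSum r →CP A),
      (∀ i, 0 < r i) ∧ (∀ x, ‖ψ x‖ ≤ ‖x‖) ∧ (∀ y, ‖φ y‖ ≤ ‖y‖) ∧
      (∀ x ∈ b, ‖φ (ψ x) - x‖ < ε) ∧ IsDecomposable φ n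

/-- The decomposition rank: the least `n` such that `n`-decomposable approximations exist,
and `∞` if there is none. -/
noncomputable def decompositionRank (A : Type*) [CStarAlgebra A] [PartialOrder A]
    [StarOrderedRing A] : ℕ∞ :=
  sInf {k : ℕ∞ | ∃ n : ℕ, k = n ∧ HasDecomposableApprox A n}

/-! ## The Cuntz semigroup `W(A)`

`M_∞(A)` is the union of the matrix algebras `M_n(A)` along the upper left corner inclusions
`Cuntz.pad`; an element of `M_∞(A)` is represented by an element of some `M_n(A)`. -/

namespace Cuntz

/-- The C*-algebra `M_n(A)`. -/
abbrev Mat (n : ℕ) (A : Type*) : Type _ := CStarMatrix (Fin n) (Fin n) A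

section

variable {A : Type*} [CStarAlgebra A]

/-- A positive element of a C*-algebra has the form `x* x`. -/
theorem exists_eq_star_mul_self {B : Type*} [NonUnitalCStarAlgebra B] [PartialOrder B]
    [StarOrderedRing B] {b : B} (hb : 0 ≤ b) : ∃ x, b = star x * x :=
  CStarAlgebra.nonneg_iff_eq_star_mul_self.1 hb

/-- The image of `a ∈ M_m(A)` in `M_N(A)`, `m ≤ N`: put `a` in the upper left corner and
fill up with zeros. -/
def pad {m : ℕ} (N : ℕ) (a : Mat m A) : Mat N A :=
  CStarMatrix.ofMatrix fun i j =>
    if h : (i : ℕ) < m ∧ (j : ℕ) < m then a ⟨i, h.1⟩ ⟨j, h.2⟩ else 0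

/-- The matrix that underlies an element of `M_n(A)`. -/
abbrev toM {n : ℕ} (a : Mat n A) : Matrix (Fin n) (Fin n) A := CStarMatrix.ofMatrix.symm a

/-- The block diagonal matrix `a ⊕ b`. -/
def dsum {m n : ℕ} (a : Mat m A) (b : Mat n A) : Mat (m + n) A :=
  CStarMatrix.ofMatrix
    (Matrix.reindex finSumFinEquiv finSumFinEquiv (Matrix.fromBlocks
      (toM a) 0 0 (toM b)))

/-- The product `v b v*` for a rectangular matrix `v`. -/
def conj {m n : ℕ} (v : Matrix (Fin m) (Fin n) A) (b : Mat n A) : Mat m A :=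
  CStarMatrix.ofMatrix (v * toM b * v.conjTranspose)

/-- The rectangular matrix with ones on the diagonal. -/
def incl (A : Type*) [CStarAlgebra A] (m N : ℕ) : Matrix (Fin m) (Fin N) A := fun i j => if (i : ℕ) = j then 1 else 0

theorem pad_apply {m : ℕ} (N : ℕ) (a : Mat m A) (i j : Fin N) : pad N a i j =
    if h : (i : ℕ) < m ∧ (j : ℕ) < m then a ⟨i, h.1⟩ ⟨j, h.2⟩ else 0 := rfl

theorem conj_apply {m n : ℕ} (v : Matrix (Fin m) (Fin n) A) (b : Mat n A) (i j : Fin m) :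
    conj v b i j = (v * toM b * v.conjTranspose : Matrix (Fin m) (Fin m) A) i j := rfl

theorem conj_conj {m n p : ℕ} (v : Matrix (Fin m) (Fin n) A) (w : Matrix (Fin n) (Fin p) A)
    (c : Mat p A) : conj v (conj w c) = conj (v * w) c := by
  simp [conj, Matrix.conjTranspose_mul, Matrix.mul_assoc]

theorem incl_mul_apply {m N p : ℕ} (h : m ≤ N) (M : Matrix (Fin N) (Fin p) A) (i : Fin m)
    (j : Fin p) : (incl A m N * M : Matrix (Fin m) (Fin p) A) i j = M (Fin.castLE h i) j := by
  rw [Matrix.mul_apply, Finset.sum_eq_single (Fin.castLE h i)]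
  · simp [incl]
  · intro k _ hk
    have : (i : ℕ) ≠ k := fun hh => hk (Fin.ext (by simp [hh]))
    simp [incl, this]
  · simp

theorem mul_incl_apply {m N p : ℕ} (M : Matrix (Fin p) (Fin m) A) (i : Fin p)
    (j : Fin N) : (M * incl A m N : Matrix (Fin p) (Fin N) A) i j =
      if h : (j : ℕ) < m then M i ⟨j, h⟩ else 0 := by
  rw [Matrix.mul_apply]
  split_ifs with h
  · rw [Finset.sum_eq_single (⟨j, h⟩ : Fin m)]
    · simp [incl]
    · intro k _ hk
      have : (k : ℕ) ≠ j := fun hh => hk (Fin.ext hh)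
      simp [incl, this]
    · simp
  · refine Finset.sum_eq_zero fun k _ => ?_
    have : (k : ℕ) ≠ j := fun hh => h (hh ▸ k.2)
    simp [incl, this]

theorem incl_mul_conjTranspose {m N : ℕ} (h : m ≤ N) :
    (incl A m N * (incl A m N).conjTranspose) = 1 := by
  ext i j
  rw [incl_mul_apply h]
  by_cases hij : i = j
  · subst hij
    rw [Matrix.one_apply_eq]
    simp [incl]
  · have : (j : ℕ) ≠ i := fun hh => hij (Fin.ext hh.symm)
    rw [Matrix.one_apply_ne hij]
    simp [incl, this]

theorem pad_eq_conj {m : ℕ} (N : ℕ) (a : Mat m A) :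
    pad N a = conj (incl A m N).conjTranspose a := by
  refine CStarMatrix.ext fun i j => ?_
  have key : ((incl A m N).conjTranspose *
      (toM a : Matrix (Fin m) (Fin m) A)).conjTranspose =
      (toM a : Matrix (Fin m) (Fin m) A).conjTranspose * incl A m N := by
    simp [Matrix.conjTranspose_mul]
  rw [conj_apply, Matrix.conjTranspose_conjTranspose, mul_incl_apply]
  by_cases hj : (j : ℕ) < m
  · have h2 := congrFun (congrFun key ⟨j, hj⟩) i
    rw [mul_incl_apply, Matrix.conjTranspose_apply] at h2
    rw [dif_pos hj, ← star_inj, h2]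
    by_cases hi : (i : ℕ) < m
    · simp [pad_apply, hi, hj]
    · simp [pad_apply, hi]
  · simp [pad_apply, hj]

theorem continuous_conj {m n : ℕ} (v : Matrix (Fin m) (Fin n) A) :
    Continuous (fun b : Mat n A => conj v b) := by
  have : Continuous fun b : Matrix (Fin n) (Fin n) A => v * b * v.conjTranspose := by fun_prop
  exact this

theorem conj_sub {m n : ℕ} (v : Matrix (Fin m) (Fin n) A) (b c : Mat n A) :
    conj v (b - c) = conj v b - conj v c := by
  have : v * (toM b - toM c) * v.conjTranspose =
      v * toM b * v.conjTranspose -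
      v * toM c * v.conjTranspose := by
    rw [Matrix.mul_sub, Matrix.sub_mul]
  exact this

theorem continuous_dsum {m n : ℕ} :
    Continuous fun x : Mat m A × Mat n A => dsum x.1 x.2 := by
  have : Continuous fun x : Matrix (Fin m) (Fin m) A × Matrix (Fin n) (Fin n) A =>
      Matrix.reindex finSumFinEquiv finSumFinEquiv (Matrix.fromBlocks x.1 0 0 x.2) := by
    refine Continuous.matrix_reindex ?_ _ _
    exact Continuous.matrix_fromBlocks continuous_fst continuous_const continuous_const
      continuous_snd
  exact this

end

section

variable {A : Type*} [CStarAlgebra A] [PartialOrder A] [StarOrderedRing A]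

/-- Cuntz subequivalence `a ≾ b` of elements of `M_∞(A)`: there is a sequence `v_k` in `M_∞(A)` with
`‖v_k b v_k* - a‖ → 0`. Here `v_k` is taken in `M_{N_k}(A)`, where `N_k` is so large that `M_{N_k}(A)`
contains `a` and `b`. -/
def Subeq {m n : ℕ} (a : Mat m A) (b : Mat n A) : Prop :=
  ∃ (N : ℕ → ℕ) (v : ∀ k, Mat (N k) A), (∀ k, m ≤ N k ∧ n ≤ N k) ∧
    Tendsto (fun k => ‖v k * pad (N k) b * star (v k) - pad (N k) a‖) atTop (𝓝 0)

/-- Cuntz subequivalence through rectangular matrices: `a ≾ b` if and only if `a` is a limit of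
elements `v b v*`. -/
theorem subeq_iff {m n : ℕ} (a : Mat m A) (b : Mat n A) :
    Subeq a b ↔ a ∈ closure (Set.range fun v : Matrix (Fin m) (Fin n) A => conj v b) := by
  constructor
  · rintro ⟨N, v, hN, hv⟩
    refine mem_closure_of_tendsto (f := fun k => conj (incl A m (N k) *
      toM (v k) * (incl A n (N k)).conjTranspose) b) (b := atTop) ?_
      (Eventually.of_forall fun k => ⟨_, rfl⟩)
    have h1 : ∀ k, conj (incl A m (N k) * toM (v k) *
        (incl A n (N k)).conjTranspose) b - a =
        conj (incl A m (N k)) (v k * pad (N k) b * star (v k) - pad (N k) a) := by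
      intro k
      have e1 : conj (incl A m (N k)) (pad (N k) a) = a := by
        rw [pad_eq_conj, conj_conj, incl_mul_conjTranspose (hN k).1]
        simp [conj]
      have e2 : v k * pad (N k) b * star (v k) =
          conj (toM (v k)) (pad (N k) b) := rfl
      rw [conj_sub, e1, e2, pad_eq_conj, conj_conj, conj_conj, Matrix.mul_assoc]
    have h2 : ∀ (k : ℕ) (i j : Fin m), ‖(conj (incl A m (N k) * toM (v k) *
        (incl A n (N k)).conjTranspose) b) i j - a i j‖ ≤
        ‖v k * pad (N k) b * star (v k) - pad (N k) a‖ := by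
      intro k i j
      have := congrFun (congrFun (h1 k) i) j
      rw [CStarMatrix.sub_apply] at this
      rw [this]
      refine le_trans (le_of_eq ?_) (CStarMatrix.norm_entry_le_norm
        (i := Fin.castLE (hN k).1 i) (j := Fin.castLE (hN k).1 j))
      congr 1
      set X := v k * pad (N k) b * star (v k) - pad (N k) a
      rw [conj_apply, Matrix.mul_assoc, incl_mul_apply (hN k).1, ← star_inj, ← Matrix.conjTranspose_apply,
        Matrix.conjTranspose_mul, Matrix.conjTranspose_conjTranspose, incl_mul_apply (hN k).1]
      rfl
    have h3 : Tendsto (fun k => (toM (conj (incl A m (N k) *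
        toM (v k) * (incl A n (N k)).conjTranspose) b) :
          Matrix (Fin m) (Fin m) A)) atTop (𝓝 (toM a)) := by
      refine tendsto_pi_nhds.2 fun i => tendsto_pi_nhds.2 fun j => ?_
      rw [tendsto_iff_norm_sub_tendsto_zero]
      exact squeeze_zero (fun _ => norm_nonneg _) (fun k => h2 k i j) hv
    exact h3
  · intro h
    obtain ⟨x, hx, hlim⟩ := mem_closure_iff_seq_limit.1 h
    choose w hw using hx
    refine ⟨fun _ => m + n, fun k => CStarMatrix.ofMatrix
      ((incl A m (m + n)).conjTranspose * w k * incl A n (m + n)), fun k => ⟨Nat.le_add_right m n, Nat.le_add_left n m⟩, ?_⟩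
    have h1 : ∀ k, CStarMatrix.ofMatrix
        ((incl A m (m + n)).conjTranspose * w k * incl A n (m + n)) * pad (m + n) b *
        star (CStarMatrix.ofMatrix
          ((incl A m (m + n)).conjTranspose * w k * incl A n (m + n))) = pad (m + n) (x k) := by
      intro k
      have e2 : ∀ v : Matrix (Fin (m + n)) (Fin (m + n)) A, CStarMatrix.ofMatrix v *
          pad (m + n) b * star (CStarMatrix.ofMatrix v) = conj v (pad (m + n) b) := fun _ => rfl
      rw [e2, pad_eq_conj, pad_eq_conj, ← hw k, conj_conj, conj_conj, Matrix.mul_assoc,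
        incl_mul_conjTranspose (by omega), Matrix.mul_one]
    simp only [h1]
    rw [← tendsto_iff_norm_sub_tendsto_zero]
    have hc : Continuous fun y : Mat m A => pad (m + n) y := by
      simp only [pad_eq_conj]
      exact continuous_conj _
    exact (hc.tendsto a).comp hlim

theorem subeq_of_eq_conj {m n : ℕ} {a : Mat m A} {b : Mat n A} (v : Matrix (Fin m) (Fin n) A)
    (h : conj v b = a) : Subeq a b :=
  (subeq_iff a b).2 (subset_closure ⟨v, h⟩)

theorem subeq_refl {m : ℕ} (a : Mat m A) : Subeq a a :=
  subeq_of_eq_conj 1 (by simp [conj])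

theorem subeq_trans {m n p : ℕ} {a : Mat m A} {b : Mat n A} {c : Mat p A}
    (h₁ : Subeq a b) (h₂ : Subeq b c) : Subeq a c := by
  rw [subeq_iff] at *
  refine closure_minimal ?_ isClosed_closure h₁
  rintro _ ⟨v, rfl⟩
  refine map_mem_closure (continuous_conj v) h₂ ?_
  rintro _ ⟨w, rfl⟩
  exact ⟨v * w, (conj_conj v w c).symm⟩

theorem subeq_dsum {m n p q : ℕ} {a : Mat m A} {b : Mat n A} {a' : Mat p A} {b' : Mat q A}
    (h₁ : Subeq a a') (h₂ : Subeq b b') : Subeq (dsum a b) (dsum a' b') := by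
  rw [subeq_iff] at *
  refine map_mem_closure₂ continuous_dsum h₁ h₂ ?_
  rintro _ ⟨v, rfl⟩ _ ⟨w, rfl⟩
  refine ⟨Matrix.reindex finSumFinEquiv finSumFinEquiv (Matrix.fromBlocks v 0 0 w), ?_⟩
  simp [conj, dsum, Matrix.fromBlocks_multiply, Matrix.fromBlocks_conjTranspose]

theorem subeq_of_equiv {m n : ℕ} {a : Mat m A} {b : Mat n A} (e : Fin m ≃ Fin n)
    (h : ∀ i j, a i j = b (e i) (e j)) : Subeq a b := by
  refine subeq_of_eq_conj ((1 : Matrix (Fin n) (Fin n) A).submatrix e id) ?_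
  refine CStarMatrix.ext fun i j => ?_
  rw [h]
  rw [conj_apply]
  simp [Matrix.mul_apply, Matrix.one_apply]

theorem dsum_nonneg {m n : ℕ} {a : Mat m A} {b : Mat n A} (ha : 0 ≤ a) (hb : 0 ≤ b) :
    0 ≤ dsum a b := by
  obtain ⟨x, rfl⟩ := exists_eq_star_mul_self ha
  obtain ⟨y, rfl⟩ := exists_eq_star_mul_self hb
  have : dsum (star x * x) (star y * y) = star (dsum x y) * dsum x y := by
    have h : Matrix.reindex finSumFinEquiv finSumFinEquiv (Matrix.fromBlocks
        ((toM x).conjTranspose * toM x) 0 0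
        ((toM y).conjTranspose * toM y)) =
        (Matrix.reindex finSumFinEquiv finSumFinEquiv (Matrix.fromBlocks
          (toM x) 0 0 (toM y))).conjTranspose *
        Matrix.reindex finSumFinEquiv finSumFinEquiv (Matrix.fromBlocks
          (toM x) 0 0 (toM y)) := by
      simp [Matrix.fromBlocks_multiply, Matrix.fromBlocks_conjTranspose]
    exact h
  rw [this]
  exact star_mul_self_nonneg _

theorem single_nonneg {a : A} (ha : 0 ≤ a) :
    0 ≤ (CStarMatrix.ofMatrix fun _ _ => a : Mat 1 A) := by
  obtain ⟨x, rfl⟩ := exists_eq_star_mul_self ha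
  have : (CStarMatrix.ofMatrix fun _ _ => star x * x : Mat 1 A) =
      star (CStarMatrix.ofMatrix fun _ _ => x : Mat 1 A) *
        (CStarMatrix.ofMatrix fun _ _ => x : Mat 1 A) := by
    refine CStarMatrix.ext fun i j => ?_
    rw [CStarMatrix.mul_apply, Fin.sum_univ_one, CStarMatrix.star_apply]
    rfl
  rw [this]
  exact star_mul_self_nonneg _

end

end Cuntz

/-- The positive elements of `M_∞(A)`, each represented in some `M_n(A)`. -/
structure PosMInfty (A : Type*) [CStarAlgebra A] [PartialOrder A] [StarOrderedRing A] where
  size : ℕ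
  val : Cuntz.Mat size A
  nonneg : 0 ≤ val

/-- The preorder on the positive elements of `M_∞(A)` is Cuntz subequivalence. -/
instance {A : Type*} [CStarAlgebra A] [PartialOrder A] [StarOrderedRing A] :
    Preorder (PosMInfty A) where
  le a b := Cuntz.Subeq a.val b.val
  le_refl a := Cuntz.subeq_refl a.val
  le_trans _ _ _ h₁ h₂ := Cuntz.subeq_trans h₁ h₂

/-- The Cuntz semigroup `W(A) = M_∞(A)_+ / ∼`, where `a ∼ b` means that `a ≾ b` and `b ≾ a`. -/
def CuntzSemigroup (A : Type*) [CStarAlgebra A] [PartialOrder A] [StarOrderedRing A] : Type _ :=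
  Antisymmetrization (PosMInfty A) (· ≤ ·)

namespace CuntzSemigroup

variable {A : Type*} [CStarAlgebra A] [PartialOrder A] [StarOrderedRing A]

/-- The order of the Cuntz semigroup: `⟨a⟩ ≤ ⟨b⟩` if and only if `a ≾ b`. -/
instance : PartialOrder (CuntzSemigroup A) :=
  inferInstanceAs (PartialOrder (Antisymmetrization (PosMInfty A) (· ≤ ·)))

/-- The class `⟨a⟩` of a positive element of `M_∞(A)`. -/
def mk (a : PosMInfty A) : CuntzSemigroup A := toAntisymmetrization (· ≤ ·) a

theorem mk_le_mk (a b : PosMInfty A) : mk a ≤ mk b ↔ Cuntz.Subeq a.val b.val := Iff.rfl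

/-- The class `⟨a⟩` of a positive element of `A = M_1(A)`. -/
def ofPos (a : A) (ha : 0 ≤ a) : CuntzSemigroup A :=
  mk ⟨1, CStarMatrix.ofMatrix fun _ _ => a, Cuntz.single_nonneg ha⟩

/-- Addition in the Cuntz semigroup: `⟨a⟩ + ⟨b⟩ = ⟨a ⊕ b⟩`. -/
instance : Add (CuntzSemigroup A) where
  add := Quotient.map₂
    (fun a b : PosMInfty A =>
      ⟨a.size + b.size, Cuntz.dsum a.val b.val, Cuntz.dsum_nonneg a.nonneg b.nonneg⟩)
    (fun _ _ h _ _ h' =>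
      ⟨Cuntz.subeq_dsum h.1 h'.1, Cuntz.subeq_dsum h.2 h'.2⟩)

theorem mk_add_mk (a b : PosMInfty A) : mk a + mk b =
    mk ⟨a.size + b.size, Cuntz.dsum a.val b.val, Cuntz.dsum_nonneg a.nonneg b.nonneg⟩ := rfl

/-- The neutral element is the class of zero. -/
instance : Zero (CuntzSemigroup A) := ⟨mk ⟨0, 0, le_rfl⟩⟩

theorem mk_eq_of_equiv {a b : PosMInfty A} (e : Fin a.size ≃ Fin b.size)
    (h : ∀ i j, a.val i j = b.val (e i) (e j)) : mk a = mk b :=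
  le_antisymm (Cuntz.subeq_of_equiv e h)
    (Cuntz.subeq_of_equiv (a := b.val) (b := a.val) e.symm (fun i j => by simp [h]))

theorem add_comm' (x y : CuntzSemigroup A) : x + y = y + x := by
  induction x using Quotient.inductionOn with | _ a => ?_
  induction y using Quotient.inductionOn with | _ b => ?_
  change mk a + mk b = mk b + mk a
  rw [mk_add_mk, mk_add_mk]
  refine mk_eq_of_equiv
    ((finSumFinEquiv.symm.trans (Equiv.sumComm _ _)).trans finSumFinEquiv) fun i j => ?_
  obtain ⟨i, rfl⟩ := finSumFinEquiv.surjective i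
  obtain ⟨j, rfl⟩ := finSumFinEquiv.surjective j
  rcases i with i | i <;> rcases j with j | j <;>
    simp [Cuntz.dsum, -finSumFinEquiv_apply_left, -finSumFinEquiv_apply_right]

theorem add_assoc' (x y z : CuntzSemigroup A) : x + y + z = x + (y + z) := by
  induction x using Quotient.inductionOn with | _ a => ?_
  induction y using Quotient.inductionOn with | _ b => ?_
  induction z using Quotient.inductionOn with | _ c => ?_
  change mk a + mk b + mk c = mk a + (mk b + mk c)
  simp only [mk_add_mk]
  refine mk_eq_of_equiv
    ((((finSumFinEquiv.symm.trans (Equiv.sumCongr finSumFinEquiv.symm (Equiv.refl _))).trans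
      (Equiv.sumAssoc _ _ _)).trans
      (Equiv.sumCongr (Equiv.refl _) finSumFinEquiv)).trans finSumFinEquiv) fun i j => ?_
  obtain ⟨i, rfl⟩ := finSumFinEquiv.surjective i
  obtain ⟨j, rfl⟩ := finSumFinEquiv.surjective j
  rcases i with i | i
  · obtain ⟨i, rfl⟩ := finSumFinEquiv.surjective i
    rcases j with j | j
    · obtain ⟨j, rfl⟩ := finSumFinEquiv.surjective j
      rcases i with i | i <;> rcases j with j | j <;>
        simp [Cuntz.dsum, -finSumFinEquiv_apply_left, -finSumFinEquiv_apply_right]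
    · rcases i with i | i <;>
        simp [Cuntz.dsum, -finSumFinEquiv_apply_left, -finSumFinEquiv_apply_right]
  · rcases j with j | j
    · obtain ⟨j, rfl⟩ := finSumFinEquiv.surjective j
      rcases j with j | j <;>
        simp [Cuntz.dsum, -finSumFinEquiv_apply_left, -finSumFinEquiv_apply_right]
    · simp [Cuntz.dsum, -finSumFinEquiv_apply_left, -finSumFinEquiv_apply_right]

theorem add_zero' (x : CuntzSemigroup A) : x + 0 = x := by
  induction x using Quotient.inductionOn with | _ a => ?_
  change mk a + mk ⟨0, 0, le_rfl⟩ = mk a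
  rw [mk_add_mk]
  refine mk_eq_of_equiv (finSumFinEquiv.symm.trans (Equiv.sumEmpty _ _)) fun i j => ?_
  obtain ⟨i, rfl⟩ := finSumFinEquiv.surjective i
  obtain ⟨j, rfl⟩ := finSumFinEquiv.surjective j
  rcases i with i | i
  · rcases j with j | j
    · simp [Cuntz.dsum, -finSumFinEquiv_apply_left, -finSumFinEquiv_apply_right]
    · exact j.elim0
  · exact i.elim0

instance : AddCommMonoid (CuntzSemigroup A) where
  add_assoc := add_assoc'
  add_comm := add_comm'
  zero_add x := (add_comm' 0 x).trans (add_zero' x)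
  add_zero := add_zero'
  nsmul := nsmulRec

end CuntzSemigroup

/-! Factor the identity approximately as `A → F → A` through `ψ` and `φ`, very accurately on a
suitable finite set. Then `a` is close to `φ (ψ a)`, which splits over the `n + 1` colours, so it
suffices that the part of colour `j` is approximately of the form `w * d j * star w`: a row of such
elements `w` witnesses subequivalence to the direct sum of the `d j`.

In a single matrix summand, comparison of positive elements means counting eigenvalues. If the
component of `ψ` there is almost multiplicative on a large finite set, the image of `a` has at most
as many eigenvalues above `ε` as the image of `d j` has above `η`, where `η` does not depend on the
matrix size. Otherwise normalized traces of counterexamples would converge along an ultrafilter to a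
tracial state `τ` with `d_τ(d j) ≤ d_τ(a)` (`exists_tracialState_dimFun_le`,
`exists_finset_comparison`). The eigenvalue count gives a matrix `v` with `v v*` within `ε` of the
image of `a` and `η v v* ≤ v ψ(d j) v*`.

On one colour, with unit `p`, preservation of orthogonality forces `φ x * φ y = φ p * φ (x * y)`
(`CompletelyPositiveMap.mul_eq_of_orthogonality_preserving`). Conjugation by `φ v` therefore carries
the matrix inequality into `A` up to powers of `h = φ p`. These are harmless where `h ≥ γ`, and the
rest of `φ (v v*)` is negligible because `φ (v v*) ≤ ‖a‖ h`
(`CompletelyPositiveMap.exists_mem_closure_norm_sub_le`).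

There remain the summands where `ψ` is not almost multiplicative. Since `ψ` and `φ` are both
contractions, the Schwarz inequality makes `φ` small on the defects `ψ (b* b) - ψ(b)* ψ(b)`
(`norm_map_defect_le`). A bad summand carries a defect of norm more than `η`, so multiplicativity up
to `h` makes `φ` of the unit of all bad summands of one colour small, irrespective of their number
and sizes (`CompletelyPositiveMap.norm_map_blockProj_le`). -/

theorem eq_zero_of_star_mul_mul_eq_zero {A : Type*} [CStarAlgebra A] {p e : A}
    (hp : IsSelfAdjoint p) (h : p * p * e = 0) :
    p * e = 0 := by
  rw [← CStarRing.star_mul_self_eq_zero_iff, star_mul, hp.star_eq, mul_assoc, ← mul_assoc p p, h,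
    mul_zero]

/-! ### Completely positive maps: Schwarz and Cauchy-Schwarz inequalities -/

section
variable {F A : Type*} [CStarAlgebra F] [PartialOrder F] [StarOrderedRing F]
  [CStarAlgebra A] [PartialOrder A] [StarOrderedRing A]

/-- This is 2-positivity on the Gram matrix of the row `(x, y)`, compressed by the column `(u, v)`.
Writing the image as `X* X` turns the expression into a sum of two squares, one for each row of `X`.
-/
theorem CompletelyPositiveMap.two_nonneg (φ : F →CP A) (x y : F) (u v : A) :
    0 ≤ star u * φ (star x * x) * u + star u * φ (star x * y) * v +
      star v * φ (star y * x) * u + star v * φ (star y * y) * v := by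
  set W : CStarMatrix (Fin 2) (Fin 2) F := CStarMatrix.ofMatrix !![x, y; 0, 0] with hW
  have h := φ.map_cstarMatrix_nonneg (star W * W) (star_mul_self_nonneg W)
  obtain ⟨X, hX⟩ := Cuntz.exists_eq_star_mul_self h
  have e : ∀ i j, φ ((star W * W) i j) = star (X 0 i) * X 0 j + star (X 1 i) * X 1 j := by
    intro i j
    have := congrFun (congrFun hX i) j
    rw [CStarMatrix.map_apply] at this
    rw [this, CStarMatrix.mul_apply, Fin.sum_univ_two, CStarMatrix.star_apply, CStarMatrix.star_apply]
  have e00 := e 0 0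
  have e01 := e 0 1
  have e10 := e 1 0
  have e11 := e 1 1
  simp only [CStarMatrix.mul_apply, Fin.sum_univ_two, CStarMatrix.star_apply] at e00 e01 e10 e11
  simp [hW] at e00 e01 e10 e11
  rw [e00, e01, e10, e11]
  have : star u * (star (X 0 0) * X 0 0 + star (X 1 0) * X 1 0) * u +
      star u * (star (X 0 0) * X 0 1 + star (X 1 0) * X 1 1) * v +
      star v * (star (X 0 1) * X 0 0 + star (X 1 1) * X 1 0) * u +
      star v * (star (X 0 1) * X 0 1 + star (X 1 1) * X 1 1) * v =
      star (X 0 0 * u + X 0 1 * v) * (X 0 0 * u + X 0 1 * v) +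
      star (X 1 0 * u + X 1 1 * v) * (X 1 0 * u + X 1 1 * v) := by
    simp only [star_add, star_mul]
    noncomm_ring
  rw [this]
  exact add_nonneg (star_mul_self_nonneg _) (star_mul_self_nonneg _)


theorem CompletelyPositiveMap.map_star' (φ : F →CP A) (x : F) : φ (star x) = star (φ x) :=
  map_star φ x

/-- The Kadison-Schwarz inequality. -/
theorem CompletelyPositiveMap.schwarz (φ : F →CP A) (h1 : φ 1 ≤ 1) (x : F) :
    star (φ x) * φ x ≤ φ (star x * x) := by
  -- The column `(-φ x, 1)` completes the square. The leftover term `star (φ x) * (1 - φ 1) * φ x`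
  -- is nonnegative by `h1` and is added as `h2`.
  have h := φ.two_nonneg 1 x (-φ x) 1
  have h2 := star_left_conjugate_le_conjugate h1 (φ x)
  simp only [star_one, one_mul, mul_one, star_neg, φ.map_star', neg_mul, mul_neg, neg_neg] at h h2
  rw [← sub_nonneg] at h2 ⊢
  have := add_nonneg h h2
  convert this using 1
  abel

theorem IsSelfAdjoint.norm_le_of_neg_le_of_le {x : A} {c : ℝ} (hc : 0 ≤ c) (hx : IsSelfAdjoint x)
    (h1 : -(algebraMap ℝ A c) ≤ x) (h2 : x ≤ algebraMap ℝ A c) : ‖x‖ ≤ c := by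
  rw [← map_neg, algebraMap_le_iff_le_spectrum] at h1
  rw [le_algebraMap_iff_spectrum_le] at h2
  rw [← cfc_id ℝ x]
  exact norm_cfc_le hc fun s hs => abs_le.2 ⟨h1 s hs, h2 s hs⟩

/-- A form of the Cauchy-Schwarz inequality for positive sesquilinear forms with values in a
C*-algebra. -/
theorem norm_sesq_le {V : Type*} [AddCommGroup V] [Module ℂ V]
    (E : V →ₗ⋆[ℂ] V →ₗ[ℂ] A) (hE : ∀ x, 0 ≤ E x x) (x y : V) {t : ℝ} (ht : 0 < t) :
    ‖E x y‖ ≤ t⁻¹ * ‖E x x‖ + t * ‖E y y‖ := by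
  set c : ℝ := t⁻¹ * ‖E x x‖ + t * ‖E y y‖ with hc
  have hc0 : 0 ≤ c := by positivity
  have hle : t⁻¹ • E x x + t • E y y ≤ algebraMap ℝ A c := by
    rw [hc, map_add]
    refine add_le_add ?_ ?_
    · rw [map_mul, Algebra.algebraMap_eq_smul_one t⁻¹, smul_mul_assoc, one_mul]
      exact smul_le_smul_of_nonneg_left (hE x).isSelfAdjoint.le_algebraMap_norm_self
        (inv_nonneg.2 ht.le)
    · rw [map_mul, Algebra.algebraMap_eq_smul_one t, smul_mul_assoc, one_mul]
      exact smul_le_smul_of_nonneg_left (hE y).isSelfAdjoint.le_algebraMap_norm_self ht.le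
  -- Positivity of the form at `x + t w y`, divided by `t`, for a complex number `w` of modulus one.
  have key : ∀ w : ℂ, w * starRingEnd ℂ w = 1 →
      0 ≤ w • E x y + (starRingEnd ℂ w) • E y x + (t⁻¹ • E x x + t • E y y) := by
    intro w hw
    have h := hE (x + ((t : ℂ) * w) • y)
    simp only [map_add, LinearMap.add_apply, map_smul, LinearMap.map_smulₛₗ, LinearMap.smul_apply,
      map_mul, Complex.conj_ofReal] at h
    have h2 := smul_nonneg (inv_nonneg.2 ht.le) h
    convert h2 using 1
    simp only [← Complex.coe_smul, smul_add, smul_smul]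
    have : (t : ℂ) ≠ 0 := by exact_mod_cast ht.ne'
    rw [show ((t⁻¹ : ℝ) : ℂ) * (t * starRingEnd ℂ w) = starRingEnd ℂ w by push_cast; field_simp,
      show ((t⁻¹ : ℝ) : ℂ) * (t * w) = w by push_cast; field_simp,
      show ((t⁻¹ : ℝ) : ℂ) * (t * w * (t * starRingEnd ℂ w)) = t * (w * starRingEnd ℂ w) by
        push_cast; field_simp, hw, mul_one]
    abel
  have key2 : ∀ w : ℂ, w * starRingEnd ℂ w = 1 →
      ‖w • E x y + (starRingEnd ℂ w) • E y x‖ ≤ c := by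
    intro w hw
    have h1 := key w hw
    have h2 := key (-w) (by rw [map_neg, neg_mul_neg, hw])
    rw [map_neg, neg_smul, neg_smul, ← neg_add] at h2
    have hsa : IsSelfAdjoint (w • E x y + (starRingEnd ℂ w) • E y x) := by
      have h3 := h1.isSelfAdjoint.sub (add_nonneg (smul_nonneg (inv_nonneg.2 ht.le) (hE x))
        (smul_nonneg ht.le (hE y))).isSelfAdjoint
      rwa [add_sub_cancel_right] at h3
    refine hsa.norm_le_of_neg_le_of_le hc0 ?_ ?_
    · rw [neg_le_iff_add_nonneg']
      rw [add_comm] at h1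
      exact h1.trans (by gcongr)
    · rw [neg_add_eq_sub, sub_nonneg] at h2
      exact h2.trans hle
  -- The values `w = 1` and `w = i` bound two self-adjoint elements, which recover `2 E x y`, each
  -- contributing at most `c`.
  have h1 := key2 1 (by simp)
  have h2 := key2 Complex.I (by simp)
  have e : (2 : ℂ) • E x y = ((1 : ℂ) • E x y + (starRingEnd ℂ 1) • E y x) +
      (-Complex.I) • (Complex.I • E x y + (starRingEnd ℂ Complex.I) • E y x) := by
    simp [smul_smul, two_smul]
    abel
  have h3 : ‖(2 : ℂ) • E x y‖ ≤ c + c := by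
    rw [e]
    refine (norm_add_le _ _).trans (add_le_add h1 ?_)
    rw [norm_smul, norm_neg, Complex.norm_I, one_mul]
    exact h2
  rw [norm_smul, Complex.norm_ofNat] at h3
  linarith

/-- A positive sesquilinear form with values in a C*-algebra vanishes on its isotropic vectors. -/
theorem sesq_eq_zero_of_isotropic {V : Type*} [AddCommGroup V] [Module ℂ V]
    (E : V →ₗ⋆[ℂ] V →ₗ[ℂ] A) (hE : ∀ x, 0 ≤ E x x) {q : V} (hq : E q q = 0) (y : V) :
    E q y = 0 := by
  have h : Tendsto (fun t : ℝ => t * ‖E y y‖) (𝓝[>] 0) (𝓝 (0 * ‖E y y‖)) :=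
    ((continuous_id.mul continuous_const).tendsto 0).mono_left nhdsWithin_le_nhds
  rw [zero_mul] at h
  rw [← norm_le_zero_iff]
  refine ge_of_tendsto h ?_
  filter_upwards [self_mem_nhdsWithin] with t ht
  simpa [hq] using norm_sesq_le E hE q y ht

end
-- Structure of orthogonality preserving maps
section
variable {F A : Type*} [CStarAlgebra F] [PartialOrder F] [StarOrderedRing F]
  [CStarAlgebra A] [PartialOrder A] [StarOrderedRing A]

/-- A completely positive map that preserves orthogonality on the corner of a central projection `p`
satisfies `φ x * φ y = φ p * φ (x * y)` there, as soon as the corner is spanned by projections. -/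
theorem CompletelyPositiveMap.mul_eq_of_orthogonality_preserving (φ : F →CP A) {p : F}
    (hp : IsStarProjection p) (hc : ∀ x, p * x = x * p)
    (horth : ∀ x y, p * x = x → p * y = y → 0 ≤ x → 0 ≤ y → x * y = 0 → φ x * φ y = 0)
    (hspan : ∀ x, p * x = x → x ∈ Submodule.span ℂ {q : F | IsStarProjection q ∧ p * q = q}) :
    (∀ x, p * x = x → Commute (φ p) (φ x)) ∧
      ∀ x y, p * x = x → p * y = y → φ x * φ y = φ p * φ (x * y) := by
  have hpp : p * p = p := hp.isIdempotentElem
  have hps : star p = p := hp.isSelfAdjoint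
  -- `q` and `p - q` are orthogonal, so `φ q` annihilates `φ p - φ q` from both sides. Commutation
  -- with `φ p` then extends from projections to their span.
  have hq : ∀ q, IsStarProjection q → p * q = q →
      φ q * φ q = φ p * φ q ∧ φ q * φ q = φ q * φ p := by
    intro q hq hpq
    have hqq : q * q = q := hq.isIdempotentElem
    have hsub : IsStarProjection (p - q) := by
      refine ⟨?_, ?_⟩
      · change (p - q) * (p - q) = p - q
        rw [mul_sub, sub_mul, sub_mul, hpp, hqq, ← hc, hpq]; abel
      · exact hp.isSelfAdjoint.sub hq.isSelfAdjoint
    have h1 := horth q (p - q) hpq (by rw [mul_sub, hpp, hpq]) hq.nonneg hsub.nonneg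
      (by rw [mul_sub, hqq, ← hc, hpq, sub_self])
    have h2 := horth (p - q) q (by rw [mul_sub, hpp, hpq]) hpq hsub.nonneg hq.nonneg
      (by rw [sub_mul, hqq, hpq, sub_self])
    rw [map_sub] at h1 h2
    constructor
    · rw [sub_mul, sub_eq_zero] at h2; exact h2.symm
    · rw [mul_sub, sub_eq_zero] at h1; exact h1.symm
  have hcomm : ∀ x, p * x = x → Commute (φ p) (φ x) := by
    intro x hx
    refine Submodule.span_induction (p := fun x _ => Commute (φ p) (φ x)) ?_ ?_ ?_ ?_ (hspan x hx)
    · rintro q ⟨h1, h2⟩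
      exact (hq q h1 h2).1.symm.trans (hq q h1 h2).2
    · rw [map_zero]; exact Commute.zero_right _
    · intro x y _ _ h1 h2
      rw [map_add]; exact h1.add_right h2
    · intro c x _ h1
      rw [map_smul]; exact h1.smul_right c
  refine ⟨hcomm, ?_⟩
  have hsx : ∀ x, p * x = x → p * star x = star x := by
    intro x hx
    rw [hc, ← hps, ← star_mul, hx]
  have hφs := φ.map_star'
  have hh : star (φ p) = φ p := by rw [← hφs, hps]
  -- The defect of the desired identity, multiplied by `φ p`, is a positive sesquilinear form.
  -- Projections under `p` are isotropic for it by `hq`; since they span the corner, the form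
  -- vanishes there.
  let E : F →ₗ⋆[ℂ] F →ₗ[ℂ] A := LinearMap.mk₂'ₛₗ (starRingEnd ℂ) (RingHom.id ℂ)
    (fun x y => φ p * (φ p * φ (p * (star x * y)) - star (φ (p * x)) * φ (p * y)))
    (fun x x' y => by simp only [star_add, add_mul, mul_add, map_add]; noncomm_ring)
    (fun c x y => by simp; rw [← smul_sub, mul_smul_comm])
    (fun x y y' => by simp only [mul_add, map_add]; noncomm_ring)
    (fun c x y => by simp; rw [← smul_sub, mul_smul_comm])
  have hEdef : ∀ x y, E x y =
    φ p * (φ p * φ (p * (star x * y)) - star (φ (p * x)) * φ (p * y)) := fun _ _ => rfl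
  have hE : ∀ x, 0 ≤ E x x := by
    intro x
    set z := p * x with hz
    have hpz : p * z = z := by rw [hz, ← mul_assoc, hpp]
    have hzz : p * (star x * x) = star z * z := by
      rw [hz, star_mul, hps, mul_assoc, ← mul_assoc p p, hpp, ← mul_assoc, ← mul_assoc, hc]
    -- As `φ p` commutes with the image of the corner, the first three of the four terms combine to
    -- `-φ p * star (φ z) * φ z`, which leaves exactly `E x x`.
    have h := φ.two_nonneg p z (-φ z) (φ p)
    rw [hps, hpp, hpz, ← hc (star z), hsx z hpz, hφs z, hh] at h
    rw [hEdef, hzz, ← hz]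
    have c1 := (hcomm z hpz).eq
    have c2 : φ p * star (φ z) = star (φ z) * φ p := by
      rw [← hφs]; exact (hcomm _ (hsx z hpz)).eq
    have c3 := (hcomm (star z * z) (by rw [← mul_assoc, hsx z hpz])).eq
    convert h using 1
    simp only [star_neg, neg_mul, mul_neg, neg_neg, mul_sub]
    rw [mul_assoc (φ p) (φ _) (φ p), ← c3, mul_assoc (star (φ z)) (φ z) (φ p), ← c1,
      ← mul_assoc (star (φ z)) (φ p), ← c2, ← mul_assoc (φ p) (star _)]
    abel
  have hEq : ∀ q, IsStarProjection q → p * q = q → ∀ y, E q y = 0 := by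
    intro q h1 h2 y
    refine sesq_eq_zero_of_isotropic E hE ?_ y
    have hqs : star q = q := h1.isSelfAdjoint
    rw [hEdef, hqs, show q * q = q from h1.isIdempotentElem, h2, ← hφs, hqs, (hq q h1 h2).1,
      sub_self, mul_zero]
  have hE0 : ∀ x y, p * x = x → E x y = 0 := by
    intro x y hx
    refine Submodule.span_induction (p := fun x _ => E x y = 0) ?_ ?_ ?_ ?_ (hspan x hx)
    · rintro q ⟨h1, h2⟩
      exact hEq q h1 h2 y
    · simp
    · intro x x' _ _ h1 h2
      simp [h1, h2]
    · intro c x _ h1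
      simp [h1]
  have main : ∀ x y, p * x = x → p * y = y → φ p * φ (star x * y) - star (φ x) * φ y = 0 := by
    intro x y hx hy
    set e := φ p * φ (star x * y) - star (φ x) * φ y with he
    have hpe : φ p * e = 0 := by
      have := hE0 x y hx
      rwa [hEdef, ← mul_assoc, hsx x hx, hx, hy] at this
    -- This removes the extra factor `φ p`: for a projection, `φ q * φ q * e = φ q * φ p * e = 0`,
    -- so `φ q * e = 0`. Since both terms of `star e` end in `φ p` or `φ x`, it follows that `star e
    -- * e = 0`.
    have hxe : ∀ z, p * z = z → φ z * e = 0 := by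
      intro z hz
      refine Submodule.span_induction (p := fun z _ => φ z * e = 0) ?_ ?_ ?_ ?_ (hspan z hz)
      · rintro q ⟨h1, h2⟩
        refine eq_zero_of_star_mul_mul_eq_zero ?_ ?_
        · change star (φ q) = φ q
          rw [← hφs, h1.isSelfAdjoint]
        · rw [(hq q h1 h2).2, mul_assoc, hpe, mul_zero]
      · simp
      · intro x x' _ _ h1 h2
        rw [map_add, add_mul, h1, h2, add_zero]
      · intro c x _ h1
        rw [map_smul, smul_mul_assoc, h1, smul_zero]
    rw [← CStarRing.star_mul_self_eq_zero_iff]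
    nth_rewrite 1 [he]
    rw [star_sub, star_mul, star_mul, star_star, hh, sub_mul, mul_assoc, hpe, mul_assoc, hxe x hx,
      mul_zero, mul_zero, sub_zero]
  intro x y hx hy
  have := main (star x) y (hsx x hx) hy
  rw [hφs, star_star, star_star, sub_eq_zero] at this
  exact this.symm

end
-- Order and Cuntz subequivalence inside `A`
section
variable {A : Type*} [CStarAlgebra A] [PartialOrder A] [StarOrderedRing A]

/-- Take `w = x^{1/2} (y + t)^{-1/2}`. With `r² = t (y + t)⁻¹` the error is `x^{1/2} r² x^{1/2}`, of
the same norm as `r x r ≤ r y r`, and `t s / (s + t) ≤ t` for `s ≥ 0`. -/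
theorem norm_sub_conj_le_of_le {x y : A} (hx : 0 ≤ x) (hxy : x ≤ y) {t : ℝ} (ht : 0 < t) :
    ∃ w : A, ‖w * y * star w - x‖ ≤ t := by
  have hy : 0 ≤ y := hx.trans hxy
  have hsp : ∀ s ∈ spectrum ℝ y, 0 ≤ s := fun s hs => spectrum_nonneg_of_nonneg hy hs
  have hpos : ∀ s ∈ spectrum ℝ y, 0 < s + t := fun s hs => by linarith [hsp s hs]
  have hc1 : ContinuousOn (fun s : ℝ => 1 / √(s + t)) (spectrum ℝ y) :=
    continuousOn_const.div (by fun_prop) fun s hs => (Real.sqrt_pos.2 (hpos s hs)).ne'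
  have hc2 : ContinuousOn (fun s : ℝ => √(t / (s + t))) (spectrum ℝ y) :=
    (continuousOn_const.div (by fun_prop) fun s hs => (hpos s hs).ne').sqrt
  set k := cfc (fun s : ℝ => 1 / √(s + t)) y with hk
  set r := cfc (fun s : ℝ => √(t / (s + t))) y with hr
  have hks : star k = k := (cfc_predicate (R := ℝ) _ y : IsSelfAdjoint k)
  have hrs : star r = r := (cfc_predicate (R := ℝ) _ y : IsSelfAdjoint r)
  have hsq : ∀ s ∈ spectrum ℝ y, √(t / (s + t)) * √(t / (s + t)) = t / (s + t) :=
    fun s hs => Real.mul_self_sqrt (div_nonneg ht.le (hpos s hs).le)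
  have e1 : 1 - k * y * k = r * r := by
    have h1 : k * y * k = cfc (fun s : ℝ => 1 / √(s + t) * s * (1 / √(s + t))) y := by
      rw [cfc_mul (fun s : ℝ => 1 / √(s + t) * s) _ y (hc1.mul (continuousOn_id' _)) hc1,
        cfc_mul _ (fun s : ℝ => s) y hc1 (continuousOn_id' _), cfc_id' ℝ y]
    rw [h1, hr, ← cfc_mul _ _ y hc2 hc2, ← cfc_const_one ℝ y,
      ← cfc_sub (fun _ => 1) (fun s : ℝ => 1 / √(s + t) * s * (1 / √(s + t))) y (by fun_prop)
        ((hc1.mul (continuousOn_id' _)).mul hc1)]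
    refine cfc_congr fun s hs => ?_
    have h0 := hpos s hs
    have h2 := Real.mul_self_sqrt h0.le
    simp only [hsq s hs]
    have h3 : √(s + t) ≠ 0 := (Real.sqrt_pos.2 h0).ne'
    rw [show 1 / √(s + t) * s * (1 / √(s + t)) = s / (√(s + t) * √(s + t)) by field_simp, h2]
    field_simp
    ring
  have e2 : ‖r * y * r‖ ≤ t := by
    have h1 : r * y * r = cfc (fun s : ℝ => √(t / (s + t)) * s * √(t / (s + t))) y := by
      rw [cfc_mul (fun s : ℝ => √(t / (s + t)) * s) _ y (hc2.mul (continuousOn_id' _)) hc2,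
        cfc_mul _ (fun s : ℝ => s) y hc2 (continuousOn_id' _), cfc_id' ℝ y]
    rw [h1]
    refine norm_cfc_le ht.le fun s hs => ?_
    have h0 := hpos s hs
    rw [mul_right_comm, hsq s hs, Real.norm_of_nonneg (mul_nonneg (div_nonneg ht.le h0.le)
      (hsp s hs)), div_mul_eq_mul_div, div_le_iff₀ h0]
    nlinarith
  set b := CFC.sqrt x with hb
  have hbb : b * b = x := CFC.sqrt_mul_sqrt_self x hx
  have hbs : star b = b := (CFC.sqrt_nonneg x).isSelfAdjoint
  refine ⟨b * k, ?_⟩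
  have e3 : b * k * y * star (b * k) - x = -(star (r * b) * (r * b)) := by
    rw [star_mul, star_mul, hks, hbs, hrs]
    calc _ = b * (k * y * k) * b - b * b := by rw [hbb]; noncomm_ring
      _ = -(b * (1 - k * y * k) * b) := by noncomm_ring
      _ = _ := by rw [e1]; noncomm_ring
  rw [e3, norm_neg, CStarRing.norm_star_mul_self, ← CStarRing.norm_self_mul_star]
  refine le_trans ?_ e2
  have h4 : r * b * star (r * b) = r * x * r := by
    rw [star_mul, hrs, hbs, ← hbb]; noncomm_ring
  rw [h4]
  have h5 := star_left_conjugate_nonneg hx r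
  have h6 := star_left_conjugate_le_conjugate hxy r
  rw [hrs] at h5 h6
  exact CStarAlgebra.norm_le_norm_of_nonneg_of_le h5 h6

/-- Apply `norm_sub_conj_le_of_le` to `κ • x`, with the tolerance scaled by `κ`, and absorb `κ` into
the conjugating element as `(√κ)⁻¹`. -/
theorem mem_closure_conj_of_smul_le {x d c : A} (hx : 0 ≤ x) {κ : ℝ} (hκ : 0 < κ)
    (h : κ • x ≤ c * d * star c) :
    x ∈ closure (Set.range fun w : A => w * d * star w) := by
  rw [Metric.mem_closure_iff]
  intro ε hε
  obtain ⟨w, hw⟩ := norm_sub_conj_le_of_le (smul_nonneg hκ.le hx) h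
    (show 0 < κ * (ε / 2) by positivity)
  refine ⟨_, ⟨(√κ)⁻¹ • (w * c), rfl⟩, ?_⟩
  have hs : (√κ)⁻¹ * (√κ)⁻¹ = κ⁻¹ := by rw [← mul_inv, Real.mul_self_sqrt hκ.le]
  have e : ((√κ)⁻¹ • (w * c)) * d * star ((√κ)⁻¹ • (w * c)) - x =
      κ⁻¹ • (w * (c * d * star c) * star w - κ • x) := by
    rw [star_smul, star_trivial, smul_mul_assoc, smul_mul_assoc, mul_smul_comm, smul_smul, hs,
      smul_sub, smul_smul, inv_mul_cancel₀ hκ.ne', one_smul, star_mul]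
    simp only [mul_assoc]
  rw [dist_comm, dist_eq_norm, e, norm_smul, norm_inv, Real.norm_of_nonneg hκ.le]
  calc κ⁻¹ * _ ≤ κ⁻¹ * (κ * (ε / 2)) := by gcongr
    _ = ε / 2 := by field_simp
    _ < ε := by linarith

end

/-! ### Sums of classes in the Cuntz semigroup -/

namespace CuntzSemigroup

variable {A : Type*} [CStarAlgebra A] [PartialOrder A] [StarOrderedRing A]

theorem diagonal_nonneg {n : ℕ} {d : Fin n → A} (hd : ∀ i, 0 ≤ d i) :
    0 ≤ (CStarMatrix.ofMatrix (Matrix.diagonal d) : Cuntz.Mat n A) := by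
  choose x hx using fun i => Cuntz.exists_eq_star_mul_self (hd i)
  have : (CStarMatrix.ofMatrix (Matrix.diagonal d) : Cuntz.Mat n A) =
      star (CStarMatrix.ofMatrix (Matrix.diagonal x) : Cuntz.Mat n A) *
        (CStarMatrix.ofMatrix (Matrix.diagonal x) : Cuntz.Mat n A) := by
    have h : Matrix.diagonal d = (Matrix.diagonal x).conjTranspose * Matrix.diagonal x := by
      rw [Matrix.diagonal_conjTranspose, Matrix.diagonal_mul_diagonal]
      congr 1; funext i; exact hx i
    exact h
  rw [this]
  exact star_mul_self_nonneg _

theorem sum_ofPos : ∀ {n : ℕ} (d : Fin n → A) (hd : ∀ i, 0 ≤ d i),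
    ∑ i, ofPos (d i) (hd i) =
      mk ⟨n, CStarMatrix.ofMatrix (Matrix.diagonal d), diagonal_nonneg hd⟩
  | 0, d, hd => by
    rw [Fin.sum_univ_zero]
    exact mk_eq_of_equiv (Equiv.refl _) fun i => i.elim0
  | n + 1, d, hd => by
    rw [Fin.sum_univ_castSucc, sum_ofPos (fun i => d i.castSucc) fun i => hd _, ofPos, mk_add_mk]
    refine mk_eq_of_equiv (Equiv.refl _) fun i j => ?_
    obtain ⟨i, rfl⟩ := finSumFinEquiv.surjective i
    obtain ⟨j, rfl⟩ := finSumFinEquiv.surjective j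
    rcases i with i | i <;> rcases j with j | j
    · simp [Cuntz.dsum, Matrix.diagonal_apply]
      rfl
    · simp [Cuntz.dsum, Matrix.diagonal_apply]
      intro h
      exact absurd (congrArg Fin.val h) (by
        rw [Fin.val_castAdd, Fin.val_natAdd]; exact (Nat.lt_add_right _ i.2).ne)
    · simp [Cuntz.dsum, Matrix.diagonal_apply]
      intro h
      exact absurd (congrArg Fin.val h) (by
        rw [Fin.val_castAdd, Fin.val_natAdd]; exact (Nat.lt_add_right _ j.2).ne')
    · obtain rfl : i = j := Subsingleton.elim (α := Fin 1) i j
      have : i = (0 : Fin 1) := Subsingleton.elim (α := Fin 1) i _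
      subst this
      simp [Cuntz.dsum]
      rfl

/-- The sum of the classes is the class of a diagonal matrix, and conjugating that matrix by the row
`v` gives the 1 × 1 matrix `∑ i, v i * d i * star (v i)`. -/
theorem ofPos_le_sum_ofPos {n : ℕ} {a : A} (ha : 0 ≤ a) {d : Fin n → A} (hd : ∀ i, 0 ≤ d i)
    (h : a ∈ closure (Set.range fun v : Fin n → A => ∑ i, v i * d i * star (v i))) :
    ofPos a ha ≤ ∑ i, ofPos (d i) (hd i) := by
  rw [sum_ofPos, ofPos, mk_le_mk, Cuntz.subeq_iff]
  have hc : Continuous fun x : A => (CStarMatrix.ofMatrix fun _ _ => x : Cuntz.Mat 1 A) := by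
    have : Continuous fun x : A => (fun _ _ => x : Matrix (Fin 1) (Fin 1) A) := by fun_prop
    exact this
  refine map_mem_closure hc h ?_
  rintro _ ⟨v, rfl⟩
  refine ⟨fun _ j => v j, CStarMatrix.ext fun i j => ?_⟩
  change (Matrix.of (fun _ j => v j) * Matrix.diagonal d *
    (Matrix.of (fun _ j => v j)).conjTranspose : Matrix (Fin 1) (Fin 1) A) i j =
    ∑ i, v i * d i * star (v i)
  rw [Matrix.mul_apply]
  simp [Matrix.mul_diagonal, Matrix.conjTranspose_apply]

end CuntzSemigroup

/-! ### Cutting down to the part where `φ p` is bounded below -/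

/-- The continuous function that is `0` on `(-∞, γ]`, `1` on `[2γ, ∞)`, and linear in between. -/
noncomputable def ramp (γ s : ℝ) : ℝ := min 1 (max 0 (s / γ - 1))

theorem continuous_ramp (γ : ℝ) : Continuous (ramp γ) := by
  unfold ramp; fun_prop

theorem ramp_nonneg (γ s : ℝ) : 0 ≤ ramp γ s := le_min zero_le_one (le_max_left _ _)

theorem ramp_le_one (γ s : ℝ) : ramp γ s ≤ 1 := min_le_left _ _

theorem ramp_eq_zero {γ s : ℝ} (hγ : 0 < γ) (h : s ≤ γ) : ramp γ s = 0 := by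
  have : s / γ - 1 ≤ 0 := by rw [sub_nonpos, div_le_one hγ]; exact h
  rw [ramp, max_eq_left this, min_eq_right zero_le_one]

theorem ramp_eq_one {γ s : ℝ} (hγ : 0 < γ) (h : 2 * γ ≤ s) : ramp γ s = 1 := by
  have : 1 ≤ s / γ - 1 := by rw [le_sub_iff_add_le, le_div_iff₀ hγ]; linarith
  rw [ramp, max_eq_right (by linarith), min_eq_left this]

section
variable {F A : Type*} [CStarAlgebra F] [PartialOrder F] [StarOrderedRing F]
  [CStarAlgebra A] [PartialOrder A] [StarOrderedRing A]

/-- Cutting down by `k = ramp γ h` moves a positive element `X ≤ C h` that commutes with `h` by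
at most `2 γ C`. -/
theorem norm_sub_ramp_mul_mul_ramp_le {h X : A} (hX : 0 ≤ X) (hh : 0 ≤ h)
    {C : ℝ} (hC : 0 ≤ C) (hXh : X ≤ C • h) (hcomm : Commute h X) {γ : ℝ} (hγ : 0 < γ) :
    ‖X - cfc (ramp γ) h * X * cfc (ramp γ) h‖ ≤ 2 * γ * C := by
  set k := cfc (ramp γ) h with hk
  have hkc : ContinuousOn (ramp γ) (spectrum ℝ h) := (continuous_ramp γ).continuousOn
  have hrc : ContinuousOn (fun s => √(1 - ramp γ s * ramp γ s)) (spectrum ℝ h) := by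
    have := continuous_ramp γ
    fun_prop
  set r := cfc (fun s => √(1 - ramp γ s * ramp γ s)) h with hr
  have hrs : star r = r := (cfc_predicate (R := ℝ) _ h : IsSelfAdjoint r)
  have hsq : ∀ s, √(1 - ramp γ s * ramp γ s) * √(1 - ramp γ s * ramp γ s) =
      1 - ramp γ s * ramp γ s := fun s =>
    Real.mul_self_sqrt (by nlinarith [ramp_nonneg γ s, ramp_le_one γ s])
  have hrr : r * r = 1 - k * k := by
    rw [hr, hk, ← cfc_mul _ _ h hrc hrc, ← cfc_mul _ _ h hkc hkc, ← cfc_const_one ℝ h,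
      ← cfc_sub (fun _ => 1) (fun s : ℝ => ramp γ s * ramp γ s) h (by fun_prop) (hkc.mul hkc)]
    exact cfc_congr fun s _ => hsq s
  have hrX : Commute r X := hcomm.cfc_real _
  have hkX : Commute k X := hcomm.cfc_real _
  -- Everything commutes and `r² = 1 - k²`. The bound is then `C ‖r h r‖`, and `(1 - ramp²) s`
  -- vanishes for `s ≥ 2γ` and is at most `2γ` below.
  have e : X - k * X * k = r * X * r := by
    rw [hrX.eq, mul_assoc X, hrr, hkX.eq, mul_sub, mul_one, mul_assoc]
  rw [e]
  have h5 := star_left_conjugate_nonneg hX r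
  have h6 := star_left_conjugate_le_conjugate hXh r
  rw [hrs] at h5 h6
  refine (CStarAlgebra.norm_le_norm_of_nonneg_of_le h5 h6).trans ?_
  rw [mul_smul_comm, smul_mul_assoc, norm_smul, Real.norm_of_nonneg hC, mul_comm _ C]
  gcongr
  have h1 : r * h * r = cfc (fun s : ℝ => √(1 - ramp γ s * ramp γ s) * s *
      √(1 - ramp γ s * ramp γ s)) h := by
    rw [cfc_mul (fun s : ℝ => √(1 - ramp γ s * ramp γ s) * s) _ h
      (hrc.mul (continuousOn_id' _)) hrc, cfc_mul _ (fun s : ℝ => s) h hrc (continuousOn_id' _),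
      cfc_id' ℝ h]
  rw [h1]
  refine norm_cfc_le (by positivity) fun s hs => ?_
  have hs0 : 0 ≤ s := spectrum_nonneg_of_nonneg hh hs
  rw [mul_right_comm, hsq s, Real.norm_of_nonneg
    (mul_nonneg (by nlinarith [ramp_nonneg γ s, ramp_le_one γ s]) hs0)]
  rcases le_total (2 * γ) s with h2 | h2
  · rw [ramp_eq_one hγ h2]; simp; exact hγ.le
  · nlinarith [ramp_nonneg γ s, mul_nonneg (mul_self_nonneg (ramp γ s)) hs0]

/-- Conjugate `d` by `k * φ v`, where `h = φ p` and `k = ramp γ h`. With `X = φ (v * star v)` the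
result dominates `k² (η h² - δ h) X`, which is at least a positive multiple of `k X k` because `k`
lives on `h ≥ γ`. -/
theorem CompletelyPositiveMap.ramp_mul_mem_closure (φ : F →CP A) {p : F} (hp : IsStarProjection p)
    (hc : ∀ x, p * x = x * p)
    (hcomm : ∀ x, p * x = x → Commute (φ p) (φ x))
    (hmul : ∀ x y, p * x = x → p * y = y → φ x * φ y = φ p * φ (x * y))
    {v y : F} (hv : p * v = v) (hy : p * y = y) {η δ γ : ℝ} (hγ : 0 < γ) (hη : 0 < η)
    (hδ : 0 ≤ δ) (hδη : δ < η * γ)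
    (hvy : η • (v * star v) ≤ v * y * star v) {d : A} (hd : φ y ≤ d + algebraMap ℝ A δ) :
    cfc (ramp γ) (φ p) * φ (v * star v) * cfc (ramp γ) (φ p) ∈
      closure (Set.range fun w : A => w * d * star w) := by
  set h := φ p with hh
  have hh0 : 0 ≤ h := map_nonneg φ hp.nonneg
  set k := cfc (ramp γ) h with hk
  have hks : star k = k := (cfc_predicate (R := ℝ) _ h : IsSelfAdjoint k)
  have hhs : star h = h := hh0.isSelfAdjoint
  have hkc : ContinuousOn (ramp γ) (spectrum ℝ h) := (continuous_ramp γ).continuousOn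
  set X := φ (v * star v) with hX
  have hX0 : 0 ≤ X := map_nonneg φ (mul_star_self_nonneg v)
  have hpv : p * (v * star v) = v * star v := by rw [← mul_assoc, hv]
  have hsv : p * star v = star v := by
    rw [hc]; nth_rewrite 1 [← hp.isSelfAdjoint.star_eq]; rw [← star_mul, hv]
  have hhX : Commute h X := hcomm _ hpv
  have hkX : Commute k X := hhX.cfc_real _
  have hkh : Commute k h := (Commute.refl h).cfc_real _
  have hφs := φ.map_star' v
  -- The value of `η s² - δ s` at `s = γ`, which is a lower bound for `s ≥ γ` because the difference
  -- is `(s - γ) (η (s + γ) - δ)`.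
  set κ := γ * (η * γ - δ) with hκ
  have hκ0 : 0 < κ := mul_pos hγ (by linarith)
  refine mem_closure_conj_of_smul_le (c := k * φ v) (κ := κ) ?_ hκ0 ?_
  · have := star_left_conjugate_nonneg hX0 k
    rwa [hks] at this
  have hlow : φ y - algebraMap ℝ A δ ≤ d := by rwa [sub_le_iff_le_add]
  refine le_trans ?_ (star_right_conjugate_le_conjugate hlow (k * φ v))
  have e1 : φ v * φ y * star (φ v) = h * φ (v * y * star v) * h := by
    rw [← hφs, hmul v y hv hy, mul_assoc, hmul (v * y) (star v) (by rw [← mul_assoc, hv]) hsv,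
      mul_assoc h (φ _) h, ← (hcomm (v * y * star v) (by rw [← mul_assoc, ← mul_assoc, hv])).eq]
  have e2 : φ v * star (φ v) = h * X := by rw [← hφs, hmul v _ hv hsv]
  have e3 : k * φ v * (φ y - algebraMap ℝ A δ) * star (k * φ v) =
      k * (h * φ (v * y * star v) * h) * k - δ • (k * (h * X) * k) := by
    rw [star_mul, hks, ← e1, ← e2, mul_sub, sub_mul, Algebra.algebraMap_eq_smul_one,
      mul_smul_comm, smul_mul_assoc, mul_one]
    simp only [mul_assoc]
  have h7 : η • X ≤ φ (v * y * star v) := by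
    have := OrderHomClass.mono φ hvy
    rwa [← Complex.coe_smul, map_smul, Complex.coe_smul] at this
  have h8 := star_left_conjugate_le_conjugate (star_left_conjugate_le_conjugate h7 h) k
  rw [hks, hhs] at h8
  rw [e3]
  refine le_trans ?_ (sub_le_sub_right h8 _)
  have hm : 0 ≤ cfc (fun s => ramp γ s * ramp γ s * (η * s * s - δ * s - κ)) h := by
    refine cfc_nonneg fun s hs => ?_
    rcases le_total s γ with h1 | h1
    · rw [ramp_eq_zero hγ h1]; simp
    · refine mul_nonneg (mul_self_nonneg _) ?_
      have : 0 ≤ (s - γ) * (η * (s + γ) - δ) := mul_nonneg (by linarith) (by nlinarith)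
      rw [hκ]; nlinarith
  have hme : cfc (fun s => ramp γ s * ramp γ s * (η * s * s - δ * s - κ)) h =
      k * k * (η • h * h - δ • h - algebraMap ℝ A κ) := by
    rw [cfc_mul (fun s => ramp γ s * ramp γ s) _ h (hkc.mul hkc) (by fun_prop),
      cfc_mul _ _ h hkc hkc, cfc_sub (fun s => η * s * s - δ * s) _ h (by fun_prop) (by fun_prop),
      cfc_sub (fun s => η * s * s) _ h (by fun_prop) (by fun_prop), cfc_const κ h,
      cfc_mul (fun s => η * s) _ h (by fun_prop) (by fun_prop), cfc_const_mul_id η h,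
      cfc_const_mul_id δ h, cfc_id' ℝ h]
  have h9 := Commute.mul_nonneg hm hX0 (hhX.cfc_real _)
  rw [← sub_nonneg]
  convert h9 using 1
  rw [hme, Algebra.algebraMap_eq_smul_one]
  have f1 : k * X * k = k * k * X := by rw [mul_assoc, ← hkX.eq, mul_assoc]
  have f2 : k * (h * X) * k = k * k * (h * X) := by
    rw [mul_assoc, ← (hkh.mul_right hkX).eq, mul_assoc]
  have f3 : k * (h * X * h) * k = k * k * (h * h * X) := by
    rw [mul_assoc h X h, ← hhX.eq, ← mul_assoc h h X, mul_assoc,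
      ← ((hkh.mul_right hkh).mul_right hkX).eq]
    simp only [mul_assoc]
  simp only [mul_smul_comm, smul_mul_assoc, mul_sub, sub_mul, mul_one] at f1 f2 f3 ⊢
  rw [f1, f2, f3]
  simp only [mul_assoc]
end

/-! ### Spanning by projections in finite-dimensional algebras -/

section
variable {n : ℕ}

/-- Dividing by `⟨u, u⟩` makes `u u*` a rank-one projection unless `u = 0`. -/
theorem vecMulVec_mem_span_projection (u : Fin n → ℂ) :
    CStarMatrix.ofMatrix (Matrix.vecMulVec u (star u)) ∈
      Submodule.span ℂ {q : CStarMatrix (Fin n) (Fin n) ℂ | IsStarProjection q} := by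
  by_cases hu : u = 0
  · subst hu
    have : (CStarMatrix.ofMatrix (Matrix.vecMulVec (0 : Fin n → ℂ) (star 0)) :
        CStarMatrix (Fin n) (Fin n) ℂ) = 0 := by
      ext i j; simp
    rw [this]; exact zero_mem _
  set c : ℂ := star u ⬝ᵥ u with hc
  have hc0 : c ≠ 0 := by rwa [hc, Ne, dotProduct_star_self_eq_zero]
  have hcs : star c = c := by simp [hc, dotProduct, mul_comm]
  have h : CStarMatrix.ofMatrix (Matrix.vecMulVec u (star u)) =
      c • CStarMatrix.ofMatrix (c⁻¹ • Matrix.vecMulVec u (star u)) := by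
    rw [CStarMatrix.smul_of, smul_smul, mul_inv_cancel₀ hc0, one_smul]
  rw [h]
  refine Submodule.smul_mem _ _ (Submodule.subset_span ⟨?_, ?_⟩)
  · change c⁻¹ • Matrix.vecMulVec u (star u) * c⁻¹ • Matrix.vecMulVec u (star u) =
      c⁻¹ • Matrix.vecMulVec u (star u)
    rw [Matrix.smul_mul, Matrix.mul_smul, Matrix.vecMulVec_mul_vecMulVec, ← hc]
    simp [hc0, smul_smul]
  · change (c⁻¹ • Matrix.vecMulVec u (star u)).conjTranspose = _
    rw [Matrix.conjTranspose_smul, star_inv₀, hcs, Matrix.conjTranspose_vecMulVec, star_star]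
    rfl

/-- Polarization writes `x y*` as a combination of four matrices `u u*`, and the matrix units have
the form `x y*`. -/
theorem mem_span_projection (M : CStarMatrix (Fin n) (Fin n) ℂ) :
    M ∈ Submodule.span ℂ {q : CStarMatrix (Fin n) (Fin n) ℂ | IsStarProjection q} := by
  have hpol : ∀ x y : Fin n → ℂ, CStarMatrix.ofMatrix (Matrix.vecMulVec x (star y)) ∈
      Submodule.span ℂ {q : CStarMatrix (Fin n) (Fin n) ℂ | IsStarProjection q} := by
    intro x y
    have e : (CStarMatrix.ofMatrix (Matrix.vecMulVec x (star y)) : CStarMatrix (Fin n) (Fin n) ℂ) =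
        (1 / 4 : ℂ) • (CStarMatrix.ofMatrix (Matrix.vecMulVec (x + y) (star (x + y))) -
          CStarMatrix.ofMatrix (Matrix.vecMulVec (x - y) (star (x - y))) +
          Complex.I • CStarMatrix.ofMatrix (Matrix.vecMulVec (x + Complex.I • y)
            (star (x + Complex.I • y))) -
          Complex.I • CStarMatrix.ofMatrix (Matrix.vecMulVec (x - Complex.I • y)
            (star (x - Complex.I • y)))) := by
      refine CStarMatrix.ext fun i j => ?_
      simp [Matrix.vecMulVec_apply]
      linear_combination (1 / 2 * x i * (starRingEnd ℂ) (y j) -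
        1 / 2 * y i * (starRingEnd ℂ) (x j)) * Complex.I_sq
    rw [e]
    have := @vecMulVec_mem_span_projection n
    refine Submodule.smul_mem _ _ (sub_mem (add_mem (sub_mem (this _) (this _)) ?_) ?_)
    · exact Submodule.smul_mem _ _ (this _)
    · exact Submodule.smul_mem _ _ (this _)
  have e : M = ∑ i, ∑ j, M i j • (CStarMatrix.ofMatrix
      (Matrix.vecMulVec (Pi.single i 1) (star (Pi.single j 1))) : CStarMatrix (Fin n) (Fin n) ℂ) := by
    change Matrix.of M = ∑ i, ∑ j, M i j • Matrix.vecMulVec (Pi.single i (1 : ℂ))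
      (star (Pi.single j (1 : ℂ)))
    ext k l
    simp [Matrix.sum_apply, Matrix.vecMulVec_apply, Pi.single_apply]
    rfl
  rw [e]
  exact sum_mem fun i _ => sum_mem fun j _ => Submodule.smul_mem _ _ (hpol _ _)

end

section
variable {s : ℕ} {r : Fin s → ℕ}

open Classical in
/-- The central projection of `M_{r_1} ⊕ ⋯ ⊕ M_{r_s}` onto the summands with index in `S`. -/
noncomputable def blockProj (r : Fin s → ℕ) (S : Set (Fin s)) : MatrixSum r :=
  fun i => if i ∈ S then 1 else 0

theorem blockProj_mul_apply (S : Set (Fin s)) [DecidablePred (· ∈ S)] (x : MatrixSum r) (i : Fin s) :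
    (blockProj r S * x) i = if i ∈ S then x i else 0 := by
  rw [Pi.mul_apply, blockProj]
  split_ifs <;> simp

theorem blockProj_comm (S : Set (Fin s)) (x : MatrixSum r) :
    blockProj r S * x = x * blockProj r S := by
  funext i
  rw [Pi.mul_apply, Pi.mul_apply, blockProj]
  split_ifs <;> simp

theorem isStarProjection_blockProj (S : Set (Fin s)) : IsStarProjection (blockProj r S) := by
  refine ⟨?_, ?_⟩
  · change blockProj r S * blockProj r S = blockProj r S
    funext i
    rw [Pi.mul_apply, blockProj]
    split_ifs <;> simp
  · change star (blockProj r S) = blockProj r S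
    funext i
    rw [Pi.star_apply, blockProj]
    split_ifs <;> simp

theorem isStarProjection_single {i : Fin s} {q : CStarMatrix (Fin (r i)) (Fin (r i)) ℂ}
    (hq : IsStarProjection q) : IsStarProjection (Pi.single i q : MatrixSum r) := by
  refine ⟨?_, ?_⟩
  · change (Pi.single i q : MatrixSum r) * Pi.single i q = Pi.single i q
    rw [← Pi.single_mul, show q * q = q from hq.isIdempotentElem]
  · change star (Pi.single i q : MatrixSum r) = Pi.single i q
    rw [← Pi.single_star, show star q = q from hq.isSelfAdjoint]

theorem blockProj_mul_single {S : Set (Fin s)} {i : Fin s} (hi : i ∈ S)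
    (x : CStarMatrix (Fin (r i)) (Fin (r i)) ℂ) :
    blockProj r S * Pi.single i x = Pi.single i x := by
  classical
  funext j
  rw [blockProj_mul_apply]
  by_cases hj : j = i
  · subst hj; simp [hi]
  · simp [hj]

theorem mem_span_projection_block {S : Set (Fin s)} {x : MatrixSum r}
    (hx : blockProj r S * x = x) :
    x ∈ Submodule.span ℂ {q : MatrixSum r | IsStarProjection q ∧ blockProj r S * q = q} := by
  classical
  have e : x = ∑ i, Pi.single i (x i) := (Finset.univ_sum_single x).symm
  rw [e]
  refine sum_mem fun i _ => ?_
  by_cases hi : i ∈ S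
  · have := Submodule.mem_map_of_mem (f := LinearMap.single ℂ
      (fun i => CStarMatrix (Fin (r i)) (Fin (r i)) ℂ) i) (mem_span_projection (x i))
    rw [Submodule.map_span] at this
    refine Submodule.span_mono ?_ this
    rintro _ ⟨q, hq, rfl⟩
    exact ⟨isStarProjection_single hq, blockProj_mul_single hi q⟩
  · have : x i = 0 := by
      have := congrFun hx i
      rw [blockProj_mul_apply, if_neg hi] at this
      exact this.symm
    rw [this, Pi.single_zero]
    exact zero_mem _

end

/-! ### Bad summands have small image -/

section
variable {A : Type*} [CStarAlgebra A] [PartialOrder A] [StarOrderedRing A]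

/-- A sum of pairwise orthogonal positive elements of norm at most `C` has norm at most `C`. -/
theorem norm_sum_le_of_orthogonal {ι : Type*} (T : Finset ι) (t : ι → A) {C : ℝ} (hC : 0 ≤ C)
    (h0 : ∀ a ∈ T, 0 ≤ t a) (hle : ∀ a ∈ T, t a ≤ algebraMap ℝ A C)
    (horth : ∀ a ∈ T, ∀ b ∈ T, a ≠ b → t a * t b = 0) : ‖∑ a ∈ T, t a‖ ≤ C := by
  set x := ∑ a ∈ T, t a with hx
  have hx0 : 0 ≤ x := Finset.sum_nonneg h0
  -- Orthogonality kills the cross terms, so `x² ≤ C x` and hence `‖x‖² ≤ C ‖x‖`. The number of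
  -- summands does not enter.
  have h1 : x * x = ∑ a ∈ T, t a * t a := by
    rw [hx, Finset.sum_mul_sum]
    refine Finset.sum_congr rfl fun a ha => ?_
    exact Finset.sum_eq_single a (fun b hb hne => horth a ha b hb hne.symm) (fun h => absurd ha h)
  have h2 : x * x ≤ C • x := by
    rw [h1, hx, Finset.smul_sum]
    refine Finset.sum_le_sum fun a ha => ?_
    have := Commute.mul_nonneg (sub_nonneg.2 (hle a ha)) (h0 a ha)
      (Commute.sub_left (Algebra.commutes C (t a)) (Commute.refl (t a)))
    rw [sub_mul, sub_nonneg, Algebra.algebraMap_eq_smul_one, smul_mul_assoc, one_mul] at this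
    exact this
  have h3 : ‖x‖ * ‖x‖ ≤ C * ‖x‖ := by
    have h4 : x * x = star x * x := by rw [hx0.isSelfAdjoint.star_eq]
    have h5 := CStarAlgebra.norm_le_norm_of_nonneg_of_le
      (by rw [h4]; exact star_mul_self_nonneg x) h2
    rwa [h4, CStarRing.norm_star_mul_self, norm_smul, Real.norm_of_nonneg hC] at h5
  rcases (norm_nonneg x).eq_or_lt with h | h
  · rwa [← h]
  · exact le_of_mul_le_mul_right h3 h

theorem norm_le_iff_le_smul_one {a : A} (ha : 0 ≤ a) {c : ℝ} (hc : 0 ≤ c) :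
    ‖a‖ ≤ c ↔ a ≤ (c : ℂ) • (1 : A) := by
  rw [CStarAlgebra.norm_le_iff_le_algebraMap a hc ha, Algebra.algebraMap_eq_smul_one,
    Complex.coe_smul]

/-- On the spectrum `η s³ ≤ δ s²`, so either `s = 0` or `s ≤ δ / η`. -/
theorem le_algebraMap_of_cube_le {t : A} (ht : 0 ≤ t) {η δ : ℝ} (hη : 0 < η) (hδ : 0 ≤ δ)
    (h : η • (t * t * t) ≤ δ • (t * t)) : t ≤ algebraMap ℝ A (δ / η) := by
  have e1 : t * t = cfc (fun s : ℝ => s * s) t := by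
    rw [cfc_mul (fun s : ℝ => s) (fun s => s) t, cfc_id' ℝ t]
  have e2 : t * t * t = cfc (fun s : ℝ => s * s * s) t := by
    rw [cfc_mul (fun s : ℝ => s * s) (fun s => s) t, ← e1, cfc_id' ℝ t]
  rw [e2, e1, ← cfc_const_mul η _ t, ← cfc_const_mul δ _ t, cfc_le_iff _ _ t] at h
  rw [le_algebraMap_iff_spectrum_le]
  intro s hs
  have hs0 : 0 ≤ s := spectrum_nonneg_of_nonneg ht hs
  rcases hs0.eq_or_lt with h0 | h0
  · rw [← h0]; positivity
  · have := h s hs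
    rw [le_div_iff₀ hη]
    have h2 : (η * s) * (s * s) ≤ δ * (s * s) := by nlinarith
    have := le_of_mul_le_mul_right h2 (by positivity)
    linarith

end

open scoped MatrixOrder in
theorem CStarMatrix.nonneg_iff_posSemidef {n : ℕ} (M : CStarMatrix (Fin n) (Fin n) ℂ) :
    0 ≤ M ↔ Matrix.PosSemidef (CStarMatrix.ofMatrix.symm M) := by
  constructor
  · intro h
    obtain ⟨x, rfl⟩ := Cuntz.exists_eq_star_mul_self h
    exact Matrix.posSemidef_conjTranspose_mul_self (CStarMatrix.ofMatrix.symm x)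
  · intro h
    obtain ⟨x, hx⟩ := CStarAlgebra.nonneg_iff_eq_star_mul_self.1
      (Matrix.nonneg_iff_posSemidef.2 h)
    have : M = star (CStarMatrix.ofMatrix x) * CStarMatrix.ofMatrix x := hx
    rw [this]
    exact star_mul_self_nonneg _

/-- If every nonzero vector had Rayleigh quotient below `η`, then `η 1 - D` would be positive
semidefinite. The reals `α` and `β` record that both inner products are real. -/
theorem CStarMatrix.exists_le_of_not_norm_le {n : ℕ} {D : CStarMatrix (Fin n) (Fin n) ℂ}
    (hD : 0 ≤ D) {η : ℝ} (hη : 0 ≤ η) (h : ¬ ‖D‖ ≤ η) :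
    ∃ (ξ : Fin n → ℂ) (α β : ℝ), 0 < α ∧ η * α ≤ β ∧ star ξ ⬝ᵥ ξ = α ∧
      star ξ ⬝ᵥ (Matrix.mulVec (CStarMatrix.ofMatrix.symm D) ξ) = β := by
  by_contra! hcon
  refine h ((norm_le_iff_le_smul_one hD hη).2 ?_)
  rw [← sub_nonneg, CStarMatrix.nonneg_iff_posSemidef]
  have hDp := (CStarMatrix.nonneg_iff_posSemidef D).1 hD
  change ((η : ℂ) • (1 : Matrix (Fin n) (Fin n) ℂ) - CStarMatrix.ofMatrix.symm D).PosSemidef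
  refine Matrix.PosSemidef.of_dotProduct_mulVec_nonneg ?_ fun ξ => ?_
  · refine Matrix.IsHermitian.sub ?_ hDp.isHermitian
    change Matrix.conjTranspose _ = _
    simp
  · have h1 := Complex.le_def.1 (dotProduct_star_self_nonneg ξ)
    have h2 := Complex.le_def.1 (hDp.dotProduct_mulVec_nonneg ξ)
    have e1 : star ξ ⬝ᵥ ξ = ((star ξ ⬝ᵥ ξ).re : ℂ) := Complex.ext rfl (by simpa using h1.2.symm)
    have e2 : star ξ ⬝ᵥ (Matrix.mulVec (CStarMatrix.ofMatrix.symm D) ξ) =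
      ((star ξ ⬝ᵥ (Matrix.mulVec (CStarMatrix.ofMatrix.symm D) ξ)).re : ℂ) :=
        Complex.ext rfl (by simpa using h2.2.symm)
    rw [Matrix.sub_mulVec, dotProduct_sub, Matrix.smul_mulVec, Matrix.one_mulVec, dotProduct_smul,
      sub_nonneg, e1, e2, smul_eq_mul, ← Complex.ofReal_mul, Complex.real_le_real]
    rcases h1.1.eq_or_lt with h3 | h3
    · have : ξ = 0 := by
        rw [← dotProduct_star_self_eq_zero, e1, ← h3]; simp
      simp [this]
    · by_contra! h4
      exact hcon ξ _ _ h3 h4.le e1 e2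

section
variable {A : Type*} [CStarAlgebra A] [PartialOrder A] [StarOrderedRing A]
  {s : ℕ} {r : Fin s → ℕ}

/-- The diagonal matrix unit of `M_{r_i}` at the place `k`. -/
noncomputable def diagUnit (r : Fin s → ℕ) (a : Σ i, Fin (r i)) : MatrixSum r :=
  Pi.single a.1 (CStarMatrix.ofMatrix (Matrix.single a.2 a.2 (1 : ℂ)))

theorem isStarProjection_diagUnit (a : Σ i, Fin (r i)) : IsStarProjection (diagUnit r a) := by
  refine isStarProjection_single ⟨?_, ?_⟩
  · change Matrix.single a.2 a.2 (1 : ℂ) * Matrix.single a.2 a.2 (1 : ℂ) =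
      Matrix.single a.2 a.2 (1 : ℂ)
    simp
  · change (Matrix.single a.2 a.2 (1 : ℂ)).conjTranspose = Matrix.single a.2 a.2 (1 : ℂ)
    simp

theorem diagUnit_mul_diagUnit {a b : Σ i, Fin (r i)} (hab : a ≠ b) :
    diagUnit r a * diagUnit r b = 0 := by
  obtain ⟨i, k⟩ := a
  obtain ⟨j, l⟩ := b
  rw [diagUnit, diagUnit]
  by_cases hij : i = j
  · subst hij
    have hkl : k ≠ l := fun h => hab (by rw [h])
    rw [← Pi.single_mul]
    have : (CStarMatrix.ofMatrix (Matrix.single k k (1 : ℂ)) *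
        CStarMatrix.ofMatrix (Matrix.single l l (1 : ℂ)) : CStarMatrix (Fin (r i)) (Fin (r i)) ℂ) =
        0 := by
      change Matrix.single k k (1 : ℂ) * Matrix.single l l (1 : ℂ) = 0
      exact Matrix.single_mul_single_of_ne _ _ _ _ hkl _
    rw [this, Pi.single_zero]
  · funext m
    rw [Pi.mul_apply, Pi.zero_apply]
    by_cases hm : m = i
    · subst hm
      rw [Pi.single_eq_of_ne (i := j) hij, mul_zero]
    · rw [Pi.single_eq_of_ne (i := i) hm, zero_mul]

open Classical in
theorem sum_diagUnit (B : Set (Fin s)) :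
    ∑ a : Σ i, Fin (r i) with a.1 ∈ B, diagUnit r a = blockProj r B := by
  rw [Finset.sum_filter, Fintype.sum_sigma]
  funext m
  rw [Finset.sum_apply, Finset.sum_eq_single m, Finset.sum_apply, blockProj]
  · split_ifs with h
    · refine CStarMatrix.ext fun k l => ?_
      simp only [diagUnit, Pi.single_eq_same]
      change (∑ x, Matrix.single x x (1 : ℂ)) k l = (1 : Matrix _ _ ℂ) k l
      rw [Matrix.sum_single_one]
    · simp
  · intro i _ hi
    rw [Finset.sum_apply]
    refine Finset.sum_eq_zero fun k _ => ?_
    split_ifs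
    · rw [diagUnit, Pi.single_eq_of_ne hi.symm]
    · rfl
  · simp

/-- If `φ` is of order zero on the summands in `S`, and each summand in `B ⊆ S` carries an element
of norm more than `η` whose image has norm at most `δ`, then `φ` is small on the unit of `B`. -/
theorem CompletelyPositiveMap.norm_map_blockProj_le (φ : MatrixSum r →CP A) {S B : Set (Fin s)}
    (hBS : B ⊆ S)
    (hmul : ∀ x y, blockProj r S * x = x → blockProj r S * y = y →
      φ x * φ y = φ (blockProj r S) * φ (x * y))
    {η δ : ℝ} (hη : 0 < η) (hδ : 0 ≤ δ)
    (hB : ∀ i ∈ B, ∃ D : MatrixSum r, 0 ≤ D ∧ ‖φ D‖ ≤ δ ∧ ¬ ‖D i‖ ≤ η) :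
    ‖φ (blockProj r B)‖ ≤ δ / η := by
  classical
  set p := blockProj r S with hp
  have hpu : ∀ a : Σ i, Fin (r i), a.1 ∈ B → p * diagUnit r a = diagUnit r a :=
    fun a ha => blockProj_mul_single (hBS ha) _
  rw [← sum_diagUnit, map_sum]
  refine norm_sum_le_of_orthogonal _ _ (by positivity) ?_ ?_ ?_
  · intro a _
    exact map_nonneg φ (isStarProjection_diagUnit a).nonneg
  · rintro ⟨i, k⟩ ha
    rw [Finset.mem_filter] at ha
    have hi : i ∈ B := ha.2
    obtain ⟨D, hD0, hDφ, hDn⟩ := hB i hi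
    obtain ⟨ξ, α, β, hα, hαβ, hξ, hDξ⟩ := CStarMatrix.exists_le_of_not_norm_le (hD0 i) hη.le hDn
    set e := diagUnit r ⟨i, k⟩ with he
    -- The matrix `e_k ξ*` transports the vector `ξ`, on which `D` is large, to the `k`-th basis
    -- vector: it turns `D` into `β e` and the unit into `α e`.
    set v : MatrixSum r :=
      Pi.single i (CStarMatrix.ofMatrix (Matrix.vecMulVec (Pi.single k 1) (star ξ))) with hv
    have hpv : p * v = v := blockProj_mul_single (hBS hi) _
    have hvs : star v =
        Pi.single i (CStarMatrix.ofMatrix (Matrix.vecMulVec ξ (Pi.single k 1))) := by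
      rw [hv, ← Pi.single_star]
      congr 1
      change (Matrix.vecMulVec (Pi.single k 1) (star ξ)).conjTranspose = _
      rw [Matrix.conjTranspose_vecMulVec, star_star, ← Pi.single_star, star_one]
      rfl
    have hE : ∀ c : ℂ, (c • e : MatrixSum r) =
        Pi.single i (CStarMatrix.ofMatrix (c • Matrix.vecMulVec (Pi.single k 1) (Pi.single k 1))) := by
      intro c
      rw [he, diagUnit, ← Pi.single_smul, ← Matrix.single_eq_single_vecMulVec_single]
      rfl
    have hvv : v * star v = (α : ℂ) • e := by
      rw [hvs, hv, ← Pi.single_mul, hE]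
      congr 1
      change Matrix.vecMulVec (Pi.single k 1) (star ξ) * Matrix.vecMulVec ξ (Pi.single k 1) = _
      rw [Matrix.vecMulVec_mul_vecMulVec, hξ, Matrix.vecMulVec_smul]
      rfl
    have hvD : v * (p * D) * star v = (β : ℂ) • e := by
      have h1 : v * (p * D) = Pi.single i (CStarMatrix.ofMatrix
          (Matrix.vecMulVec (Pi.single k 1) (star ξ)) * D i) := by
        rw [← mul_assoc, ← blockProj_comm, hpv, hv, Pi.single_mul_left]
      rw [h1, hvs, ← Pi.single_mul, hE]
      congr 1
      change Matrix.vecMulVec (Pi.single k 1) (star ξ) * CStarMatrix.ofMatrix.symm (D i) *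
        Matrix.vecMulVec ξ (Pi.single k 1) = _
      rw [Matrix.mul_assoc, Matrix.mul_vecMulVec, Matrix.vecMulVec_mul_vecMulVec, hDξ,
        Matrix.vecMulVec_smul]
      rfl
    set h := φ p with hh
    set t := φ e with ht
    have hpe : p * e = e := hpu ⟨i, k⟩ hi
    have hee : e * e = e := (isStarProjection_diagUnit (r := r) ⟨i, k⟩).isIdempotentElem
    have ht0 : 0 ≤ t := map_nonneg φ (isStarProjection_diagUnit (r := r) ⟨i, k⟩).nonneg
    have htt : h * t = t * t := by rw [hmul e e hpe hpe, hee]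
    have hsv : p * star v = star v := by
      rw [hp, blockProj_comm, ← (isStarProjection_blockProj S).isSelfAdjoint.star_eq, ← star_mul,
        hpv]
    have hpD : φ (p * D) ≤ (δ : ℂ) • (1 : A) := by
      refine le_trans ?_ ((norm_le_iff_le_smul_one (map_nonneg φ hD0) hδ).1 hDφ)
      refine OrderHomClass.mono φ fun m => ?_
      rw [hp, blockProj_mul_apply]
      split_ifs
      · exact le_rfl
      · exact hD0 m
    have h1 := star_right_conjugate_le_conjugate hpD (φ v)
    -- Multiplicativity up to `h` and `h t = t²` turn the image of `β e` into `β t³`. Against `φ (p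
    -- * D) ≤ δ` this gives `η α t³ ≤ δ α t²`.
    have e1 : φ v * φ (p * D) * star (φ v) = (β : ℂ) • (t * t * t) := by
      rw [← φ.map_star', hmul v _ hpv (by
        rw [← mul_assoc, show p * p = p from (isStarProjection_blockProj S).isIdempotentElem]),
        mul_assoc, hmul _ _ (by rw [← mul_assoc, hpv]) hsv, hvD, map_smul, mul_smul_comm,
        mul_smul_comm, ← ht, htt, ← mul_assoc, htt]
    have e2 : φ v * ((δ : ℂ) • (1 : A)) * star (φ v) = (δ * α : ℂ) • (t * t) := by
      rw [mul_smul_comm, mul_one, smul_mul_assoc, ← φ.map_star', hmul v _ hpv hsv, hvv, map_smul,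
        mul_smul_comm, smul_smul, htt]
    rw [e1, e2] at h1
    refine le_algebraMap_of_cube_le ht0 hη hδ ?_
    have ht3 : 0 ≤ t * t * t := by
      have := star_left_conjugate_nonneg ht0 t
      rwa [ht0.isSelfAdjoint.star_eq] at this
    have h2 : (η * α) • (t * t * t) ≤ (δ * α) • (t * t) := by
      refine (smul_le_smul_of_nonneg_right hαβ ht3).trans ?_
      rwa [← Complex.ofReal_mul, Complex.coe_smul, Complex.coe_smul] at h1
    have h3 := smul_le_smul_of_nonneg_left h2 (inv_nonneg.2 hα.le)
    rw [smul_smul, smul_smul] at h3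
    convert h3 using 2 <;> field_simp
  · intro a ha b hb hab
    rw [Finset.mem_filter] at ha hb
    rw [hmul _ _ (hpu a ha.2) (hpu b hb.2), diagUnit_mul_diagUnit hab, map_zero, mul_zero]

end

/-! ### Comparison of positive matrices by counting eigenvalues -/

/-- The indicator function of `(ε, ∞)`. -/
noncomputable def indic (ε s : ℝ) : ℝ := if ε < s then 1 else 0

section
variable {B : Type*} [CStarAlgebra B] {n : ℕ}

/-- One diagonalization serves all functions `f`. No continuity is required because the spectrum is
finite, so `f` may be `indic`. -/
theorem StarAlgEquiv.cfc_eq_map_diagonal (Φ : Matrix (Fin n) (Fin n) ℂ ≃⋆ₐ[ℂ] B) {X : B}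
    (hX : IsSelfAdjoint X) : ∃ (U : Matrix (Fin n) (Fin n) ℂ) (l : Fin n → ℝ),
      U * star U = 1 ∧ star U * U = 1 ∧ (∀ i, l i ∈ spectrum ℝ X) ∧
      ∀ f : ℝ → ℝ, cfc f X = Φ (U * Matrix.diagonal (fun i => (f (l i) : ℂ)) * star U) := by
  have hM : (Φ.symm X).IsHermitian := by
    change star (Φ.symm X) = Φ.symm X
    rw [← map_star, hX.star_eq]
  refine ⟨hM.eigenvectorUnitary, hM.eigenvalues, ?_, ?_, fun i => ?_, fun f => ?_⟩
  · exact Unitary.coe_mul_star_self _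
  · exact Unitary.coe_star_mul_self _
  · have := hM.eigenvalues_mem_spectrum_real i
    have h0 : spectrum ℝ (Φ.symm X) = spectrum ℝ X :=
      AlgEquiv.spectrum_eq (Φ.symm.toAlgEquiv.restrictScalars ℝ) X
    rwa [h0] at this
  · have hcont : Continuous Φ := by
      exact LinearMap.continuous_of_finiteDimensional (Φ : Matrix (Fin n) (Fin n) ℂ ≃⋆ₐ[ℂ] B).toAlgEquiv.toLinearMap
    have h1 := StarAlgHomClass.map_cfc (S := ℂ) Φ f (Φ.symm X)
      (Matrix.finite_real_spectrum.continuousOn f) hcont hM (by simpa using hX)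
    rw [hM.cfc_eq f] at h1
    simp only [StarAlgEquiv.apply_symm_apply] at h1
    rw [← h1]
    rfl

theorem StarAlgEquiv.trace_symm_map (Φ : Matrix (Fin n) (Fin n) ℂ ≃⋆ₐ[ℂ] B)
    {U : Matrix (Fin n) (Fin n) ℂ} (hU : star U * U = 1) (l : Fin n → ℝ) (ε : ℝ) :
    (Φ.symm (Φ (U * Matrix.diagonal (fun i => (indic ε (l i) : ℂ)) * star U))).trace.re =
      Fintype.card {i // ε < l i} := by
  rw [StarAlgEquiv.symm_apply_apply, Matrix.trace_mul_comm, ← mul_assoc, hU, one_mul,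
    Matrix.trace_diagonal, ← Complex.ofReal_sum, Complex.ofReal_re, Fintype.card_subtype]
  simp [indic, Finset.sum_boole]

end

section
variable {B : Type*} [CStarAlgebra B] [PartialOrder B] [StarOrderedRing B] {n : ℕ}

theorem StarAlgEquiv.map_matrix_nonneg (Φ : Matrix (Fin n) (Fin n) ℂ ≃⋆ₐ[ℂ] B)
    (U : Matrix (Fin n) (Fin n) ℂ) {d : Fin n → ℝ} (hd : ∀ i, 0 ≤ d i) :
    0 ≤ Φ (U * Matrix.diagonal (fun i => (d i : ℂ)) * star U) := by
  have e : U * Matrix.diagonal (fun i => (d i : ℂ)) * star U =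
      U * Matrix.diagonal (fun i => (√(d i) : ℂ)) *
        star (U * Matrix.diagonal (fun i => (√(d i) : ℂ))) := by
    rw [star_mul, Matrix.star_eq_conjTranspose (Matrix.diagonal _), Matrix.diagonal_conjTranspose,
      ← mul_assoc, mul_assoc U (Matrix.diagonal _) (Matrix.diagonal _),
      Matrix.diagonal_mul_diagonal]
    congr 3
    funext i
    simp [← Complex.ofReal_mul, Real.mul_self_sqrt (hd i)]
  rw [e, map_mul, map_star]
  exact mul_star_self_nonneg _

/-- Comparison of positive matrices by the number of their large eigenvalues. -/
theorem exists_conj_of_trace_le (Φ : Matrix (Fin n) (Fin n) ℂ ≃⋆ₐ[ℂ] B) {X Y : B} (hX : 0 ≤ X)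
    (hY : 0 ≤ Y) {ε η : ℝ} (hε : 0 ≤ ε)
    (h : (Φ.symm (cfc (indic ε) X)).trace.re ≤ (Φ.symm (cfc (indic η) Y)).trace.re) :
    ∃ v : B, v * star v ≤ X ∧ X ≤ v * star v + (ε : ℂ) • 1 ∧
      (η : ℂ) • (v * star v) ≤ v * Y * star v := by
  obtain ⟨U, l, hU1, hU2, hlX, hl⟩ := Φ.cfc_eq_map_diagonal hX.isSelfAdjoint
  obtain ⟨W, m, hW1, hW2, -, hm⟩ := Φ.cfc_eq_map_diagonal hY.isSelfAdjoint
  rw [hl, hm, Φ.trace_symm_map hU2, Φ.trace_symm_map hW2, Nat.cast_le] at h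
  -- The traces of the spectral projections count the large eigenvalues, so those of `X` inject into
  -- those of `Y`.
  obtain ⟨σ⟩ := Function.Embedding.nonempty_of_card_le h
  have hXe : X = Φ (U * Matrix.diagonal (fun i => (l i : ℂ)) * star U) := by
    rw [← hl (fun s => s), cfc_id' ℝ X]
  have hYe : Y = Φ (W * Matrix.diagonal (fun i => (m i : ℂ)) * star W) := by
    rw [← hm (fun s => s), cfc_id' ℝ Y]
  have hl0 : ∀ i, 0 ≤ l i := fun i => spectrum_nonneg_of_nonneg hX (hlX i)
  -- A weighted partial permutation along `σ`. The weights `√(l k - ε)` make `v * star v` equal to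
  -- `(X - ε)₊`, while `v * Y * star v` has the additional factor `m (σ k) > η` on each eigenvector.
  set T : Matrix (Fin n) (Fin n) ℂ := Matrix.of fun k j =>
    if hk : ε < l k then (if j = σ ⟨k, hk⟩ then (√(l k - ε) : ℂ) else 0) else 0 with hT
  have hTT : ∀ g : Fin n → ℝ, T * Matrix.diagonal (fun i => (g i : ℂ)) * star T =
      Matrix.diagonal (fun k => ((if hk : ε < l k then (l k - ε) * g (σ ⟨k, hk⟩) else 0 : ℝ) : ℂ)) := by
    intro g
    ext k k'
    rw [Matrix.mul_apply]
    simp only [Matrix.mul_diagonal, Matrix.star_apply, hT, Matrix.of_apply, Matrix.diagonal_apply]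
    by_cases hk : ε < l k
    · by_cases hk' : ε < l k'
      · simp only [hk, hk', dif_pos]
        rw [Finset.sum_eq_single ((σ ⟨k, hk⟩ : {i // η < m i}) : Fin n)]
        · by_cases hkk : k = k'
          · subst hkk
            have h1 : ((√(l k - ε) : ℝ) : ℂ) * ((√(l k - ε) : ℝ) : ℂ) = (l k - ε : ℝ) := by
              rw [← Complex.ofReal_mul, Real.mul_self_sqrt (by linarith)]
            simp
            rw [mul_right_comm, h1]
            simp
          · have : ((σ ⟨k, hk⟩ : {i // η < m i}) : Fin n) ≠ σ ⟨k', hk'⟩ := by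
              intro h
              exact hkk (congrArg Subtype.val (σ.injective (Subtype.ext h)))
            simp [hkk, this]
        · intro j _ hj
          simp [hj]
        · simp
      · have hkk : k ≠ k' := by rintro rfl; exact hk' hk
        simp [hk', hkk]
    · simp [hk]
  set v : B := Φ (U * T * star W) with hv
  have hvY : ∀ g : Fin n → ℝ,
      v * Φ (W * Matrix.diagonal (fun i => (g i : ℂ)) * star W) * star v =
      Φ (U * Matrix.diagonal
        (fun k => ((if hk : ε < l k then (l k - ε) * g (σ ⟨k, hk⟩) else 0 : ℝ) : ℂ)) * star U) := by
    intro g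
    rw [← hTT, hv, ← map_star, ← map_mul, ← map_mul]
    congr 1
    simp only [star_mul, star_star, mul_assoc]
    simp only [← mul_assoc (star W) W, hW2, one_mul]
  have hvv : v * star v = Φ (U * Matrix.diagonal
        (fun k => ((if ε < l k then l k - ε else 0 : ℝ) : ℂ)) * star U) := by
    have := hvY (fun _ => 1)
    simp only [mul_one, Complex.ofReal_one, Matrix.diagonal_one, hW1, map_one, dite_eq_ite] at this
    exact this
  have hsub : ∀ f g : Fin n → ℝ, (∀ i, f i ≤ g i) →
      Φ (U * Matrix.diagonal (fun i => (f i : ℂ)) * star U) ≤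
        Φ (U * Matrix.diagonal (fun i => (g i : ℂ)) * star U) := by
    intro f g hfg
    rw [← sub_nonneg, ← map_sub, ← sub_mul, ← mul_sub, Matrix.diagonal_sub]
    have := Φ.map_matrix_nonneg U (d := fun i => g i - f i) (fun i => sub_nonneg.2 (hfg i))
    simpa using this
  have hc : ∀ c : ℝ, (c : ℂ) • (1 : B) =
      Φ (U * Matrix.diagonal (fun _ => (c : ℂ)) * star U) := by
    intro c
    rw [← Matrix.smul_one_eq_diagonal, mul_smul_comm, mul_one, smul_mul_assoc, hU1, map_smul,
      map_one]
  refine ⟨v, ?_, ?_, ?_⟩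
  · rw [hvv, hXe]
    refine hsub _ _ fun i => ?_
    split_ifs
    · linarith
    · exact hl0 i
  · rw [hvv, hc, hXe, ← map_add, ← add_mul, ← mul_add, Matrix.diagonal_add]
    have := hsub l (fun k => (if ε < l k then l k - ε else 0) + ε) (fun i => by
      split_ifs with h
      · linarith
      · linarith)
    simpa using this
  · rw [hYe, hvY, hvv, ← map_smul, ← smul_mul_assoc, ← mul_smul_comm, ← Matrix.diagonal_smul]
    have := hsub (fun k => η * (if ε < l k then l k - ε else 0))
      (fun k => if hk : ε < l k then (l k - ε) * m (σ ⟨k, hk⟩) else 0) (fun i => by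
        by_cases hk : ε < l i
        · simp only [hk, if_true, dif_pos]
          rw [mul_comm]
          exact mul_le_mul_of_nonneg_left (σ ⟨i, hk⟩).2.le (by linarith)
        · simp [hk])
    have e : (fun i => ((η * (if ε < l i then l i - ε else 0) : ℝ) : ℂ)) =
        (η : ℂ) • fun i => ((if ε < l i then l i - ε else 0 : ℝ) : ℂ) := by
      funext i; exact Complex.ofReal_mul _ _
    rw [e] at this
    exact this
end

/-! ### Asymptotically multiplicative maps -/

section
variable {A : Type*} [CStarAlgebra A]
  {B : Type*} [CStarAlgebra B] [PartialOrder B] [StarOrderedRing B]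

/-- The defect of multiplicativity of a map that satisfies the Schwarz inequality. -/
theorem norm_map_mul_sub_le (ψ : A →ₗ[ℂ] B)
    (hS : ∀ x, star (ψ x) * ψ x ≤ ψ (star x * x)) (x y : A) {t : ℝ} (ht : 0 < t) :
    ‖ψ (star x * y) - star (ψ x) * ψ y‖ ≤ t⁻¹ * ‖ψ (star x * x) - star (ψ x) * ψ x‖ +
      t * ‖ψ (star y * y) - star (ψ y) * ψ y‖ := by
  let E : A →ₗ⋆[ℂ] A →ₗ[ℂ] B := LinearMap.mk₂'ₛₗ (starRingEnd ℂ) (RingHom.id ℂ)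
    (fun x y => ψ (star x * y) - star (ψ x) * ψ y)
    (fun x x' y => by simp only [star_add, add_mul, map_add]; abel)
    (fun c x y => by simp [smul_sub])
    (fun x y y' => by simp only [mul_add, map_add]; abel)
    (fun c x y => by simp [smul_sub])
  exact norm_sesq_le E (fun x => sub_nonneg.2 (hS x)) x y ht

end

section
variable {A : Type*} [CStarAlgebra A]
  {ι : Type*} {l : Filter ι} {B : ι → Type*} [∀ i, CStarAlgebra (B i)]

/-- The defect is a positive sesquilinear form, so Cauchy-Schwarz bounds it by its diagonal values.
One of these tends to zero and the other is below `M`; `t = ε / (2 M)` balances them. -/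
theorem tendsto_norm_map_mul_sub [∀ i, PartialOrder (B i)] [∀ i, StarOrderedRing (B i)]
    (ψ : ∀ i, A →ₗ[ℂ] B i) (hstar : ∀ i x, ψ i (star x) = star (ψ i x))
    (hnorm : ∀ i x, ‖ψ i x‖ ≤ ‖x‖)
    (hS : ∀ i x, star (ψ i x) * ψ i x ≤ ψ i (star x * x))
    (hD : ∀ x, Tendsto (fun i => ‖ψ i (star x * x) - star (ψ i x) * ψ i x‖) l (𝓝 0)) (x y : A) :
    Tendsto (fun i => ‖ψ i (x * y) - ψ i x * ψ i y‖) l (𝓝 0) := by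
  rw [Metric.tendsto_nhds]
  intro ε hε
  set M : ℝ := ‖star y * y‖ + ‖y‖ * ‖y‖ + 1 with hM
  have hM0 : 0 < M := by positivity
  set t := ε / (2 * M) with ht
  have ht0 : 0 < t := by positivity
  have h1 := (Metric.tendsto_nhds.1 (hD (star x))) (t * (ε / 2)) (by positivity)
  filter_upwards [h1] with i hi
  rw [Real.dist_0_eq_abs, abs_of_nonneg (norm_nonneg _)] at hi ⊢
  have h2 := norm_map_mul_sub_le (ψ i) (hS i) (star x) y ht0
  rw [star_star, hstar i x, star_star] at h2
  rw [star_star, hstar i x, star_star] at hi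
  have h3 : ‖ψ i (star y * y) - star (ψ i y) * ψ i y‖ < M := by
    refine (norm_sub_le _ _).trans_lt ?_
    have h4 := hnorm i (star y * y)
    have h5 : ‖star (ψ i y) * ψ i y‖ ≤ ‖y‖ * ‖y‖ := by
      refine (norm_mul_le _ _).trans ?_
      rw [norm_star]
      gcongr <;> exact hnorm i y
    rw [hM]; linarith
  calc _ ≤ _ := h2
    _ < t⁻¹ * (t * (ε / 2)) + t * M := by gcongr
    _ = ε := by rw [ht]; field_simp; ring

theorem mul_aeval_C_mul_X_pow_succ (b : A) (c : ℝ) (k : ℕ) :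
    b * Polynomial.aeval b (Polynomial.C c * Polynomial.X ^ (k + 1)) =
      b * Polynomial.aeval b (Polynomial.C c * Polynomial.X ^ k) * b := by
  rw [pow_succ, ← mul_assoc, map_mul _ _ Polynomial.X, Polynomial.aeval_X, mul_assoc]

theorem norm_cfc_sub_mul_aeval_le [PartialOrder A] [StarOrderedRing A] {f : ℝ → ℝ}
    (hf : Continuous f) (Q : Polynomial ℝ) {M κ : ℝ} (hκ : 0 ≤ κ)
    (hQ : ∀ s ∈ Set.Icc 0 M, |f s - s * Q.eval s| ≤ κ) {b : A} (hb : 0 ≤ b) (hbM : ‖b‖ ≤ M) :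
    ‖cfc f b - b * Polynomial.aeval b Q‖ ≤ κ := by
  have e : b * Polynomial.aeval b Q = cfc (fun s => s * Q.eval s) b := by
    rw [cfc_mul (fun s => s) _ b (by fun_prop) (by fun_prop), cfc_id' ℝ b, cfc_polynomial Q b]
  rw [e, ← cfc_sub f (fun s => s * Q.eval s) b hf.continuousOn (by fun_prop)]
  refine norm_cfc_le hκ fun s hs => hQ s ⟨spectrum_nonneg_of_nonneg hb hs, ?_⟩
  have := (le_algebraMap_iff_spectrum_le (R := ℝ) (hb.isSelfAdjoint)).1
    hb.isSelfAdjoint.le_algebraMap_norm_self s hs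
  exact this.trans hbM

/-- The leading factor `a` excludes constant terms, on which a non-unital `ψ` would fail; the
induction on the degree multiplies by `a` on the right. -/
theorem tendsto_norm_map_mul_aeval_sub (ψ : ∀ i, A →ₗ[ℂ] B i) (hnorm : ∀ i x, ‖ψ i x‖ ≤ ‖x‖)
    (hmul : ∀ x y, Tendsto (fun i => ‖ψ i (x * y) - ψ i x * ψ i y‖) l (𝓝 0)) (a : A) (Q : Polynomial ℝ) :
    Tendsto (fun i => ‖ψ i (a * Polynomial.aeval a Q) - ψ i a * Polynomial.aeval (ψ i a) Q‖) l
      (𝓝 0) := by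
  induction Q using Polynomial.induction_on with
  | C c =>
    refine tendsto_const_nhds.congr fun i => ?_
    rw [Polynomial.aeval_C, Polynomial.aeval_C, Algebra.algebraMap_eq_smul_one,
      Algebra.algebraMap_eq_smul_one, mul_smul_comm, mul_smul_comm, mul_one, mul_one,
      ← Complex.coe_smul, map_smul, ← Complex.coe_smul, sub_self, norm_zero]
  | add p q hp hq =>
    refine squeeze_zero (fun _ => norm_nonneg _) (fun i => ?_) (by simpa using hp.add hq)
    rw [map_add, map_add, mul_add, mul_add, map_add, add_sub_add_comm]
    exact norm_add_le _ _
  | monomial k c h =>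
    have h2 := hmul (a * Polynomial.aeval a (Polynomial.C c * Polynomial.X ^ k)) a
    refine squeeze_zero (fun _ => norm_nonneg _) (fun i => ?_)
      (by simpa only [zero_mul, add_zero] using h2.add (h.mul_const ‖a‖))
    rw [mul_aeval_C_mul_X_pow_succ, mul_aeval_C_mul_X_pow_succ]
    calc _ = ‖_ + (ψ i (a * Polynomial.aeval a (Polynomial.C c * Polynomial.X ^ k)) -
          ψ i a * Polynomial.aeval (ψ i a) (Polynomial.C c * Polynomial.X ^ k)) * ψ i a‖ := by
          rw [sub_mul, sub_add_sub_cancel]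
      _ ≤ _ := norm_add_le _ _
      _ ≤ _ := by
        gcongr
        refine (norm_mul_le _ _).trans ?_
        gcongr
        exact hnorm i a

/-- Weierstrass approximation reduces to polynomials. As `f 0 = 0`, the constant term of a
polynomial `P` within `ε / 6` of `f` can be dropped, which leaves an error of at most `ε / 3`. -/
theorem tendsto_norm_map_cfc_sub (ψ : ∀ i, A →ₗ[ℂ] B i) (hnorm : ∀ i x, ‖ψ i x‖ ≤ ‖x‖)
    (hmul : ∀ x y, Tendsto (fun i => ‖ψ i (x * y) - ψ i x * ψ i y‖) l (𝓝 0))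
    [PartialOrder A] [StarOrderedRing A] [∀ i, PartialOrder (B i)] [∀ i, StarOrderedRing (B i)]
    (hpos : ∀ i x, 0 ≤ x → 0 ≤ ψ i x) {a : A} (ha : 0 ≤ a) {f : ℝ → ℝ} (hf : Continuous f)
    (hf0 : f 0 = 0) :
    Tendsto (fun i => ‖ψ i (cfc f a) - cfc f (ψ i a)‖) l (𝓝 0) := by
  rw [Metric.tendsto_nhds]
  intro ε hε
  obtain ⟨P, hP⟩ := exists_polynomial_near_of_continuousOn 0 ‖a‖ f hf.continuousOn (ε / 6)
    (by positivity)
  set Q := P.divX with hQ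
  have hPQ : ∀ s, P.eval s = s * Q.eval s + P.eval 0 := by
    intro s
    conv_lhs => rw [← Polynomial.divX_mul_X_add P]
    simp [← Polynomial.coeff_zero_eq_eval_zero]
    ring
  have hP0 := hP 0 ⟨le_rfl, norm_nonneg a⟩
  rw [hf0, sub_zero] at hP0
  have hQ : ∀ s ∈ Set.Icc 0 ‖a‖, |f s - s * Q.eval s| ≤ ε / 3 := by
    intro s hs
    have h1 := abs_lt.1 (hP s hs)
    have h2 := abs_lt.1 hP0
    have h3 := hPQ s
    rw [abs_le]
    constructor <;> linarith [h1.1, h1.2, h2.1, h2.2]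
  have h1 := (Metric.tendsto_nhds.1 (tendsto_norm_map_mul_aeval_sub ψ hnorm hmul a Q)) (ε / 3)
    (by positivity)
  filter_upwards [h1] with i hi
  rw [Real.dist_0_eq_abs, abs_of_nonneg (norm_nonneg _)] at hi ⊢
  have h2 := norm_cfc_sub_mul_aeval_le hf Q (by positivity) hQ ha le_rfl
  have h3 := norm_cfc_sub_mul_aeval_le hf Q (by positivity) hQ (hpos i a ha) (hnorm i a)
  have h4 := (hnorm i _).trans h2
  rw [map_sub] at h4
  rw [norm_sub_rev] at h3
  have h5 := norm_add₃_le (a := ψ i (cfc f a) - ψ i (a * Polynomial.aeval a Q))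
    (b := ψ i (a * Polynomial.aeval a Q) - ψ i a * Polynomial.aeval (ψ i a) Q)
    (c := ψ i a * Polynomial.aeval (ψ i a) Q - cfc f (ψ i a))
  rw [sub_add_sub_cancel, sub_add_sub_cancel] at h5
  linarith

end

/-! ### Traces weighted by a projection -/

section
variable {B : Type*} [CStarAlgebra B] {Tr : B →ₗ[ℂ] ℂ}

theorem trace_projection_mul_nonneg [PartialOrder B] [StarOrderedRing B]
    (hTr : ∀ x, 0 ≤ Tr (star x * x)) (hcomm : ∀ x y, Tr (x * y) = Tr (y * x))
    {p Y : B} (hp : IsStarProjection p) (hY : 0 ≤ Y) : 0 ≤ Tr (p * Y) := by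
  obtain ⟨z, rfl⟩ := Cuntz.exists_eq_star_mul_self hY
  have h1 : p * p = p := hp.isIdempotentElem
  have h := hTr (z * p)
  rwa [star_mul, hp.isSelfAdjoint.star_eq, mul_assoc, hcomm, mul_assoc, mul_assoc, h1,
    ← mul_assoc, hcomm] at h

/-- Cauchy-Schwarz for the trace form at `p` and `M * p`, with parameter `‖M‖⁻¹`. The bound involves
`Tr p` rather than the trace of the unit, so the functionals `Tr (p ·) / Tr p` are bounded uniformly
in the matrix size. -/
theorem norm_trace_projection_mul_le [PartialOrder B] [StarOrderedRing B]
    (hTr : ∀ x, 0 ≤ Tr (star x * x)) (hcomm : ∀ x y, Tr (x * y) = Tr (y * x))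
    {p : B} (hp : IsStarProjection p) (M : B) : ‖Tr (p * M)‖ ≤ 2 * ‖M‖ * (Tr p).re := by
  have hpp : p * p = p := hp.isIdempotentElem
  have hps : star p = p := hp.isSelfAdjoint
  let E : B →ₗ⋆[ℂ] B →ₗ[ℂ] ℂ := LinearMap.mk₂'ₛₗ (starRingEnd ℂ) (RingHom.id ℂ)
    (fun x y => Tr (star x * y))
    (fun x x' y => by simp only [star_add, add_mul, map_add])
    (fun c x y => by simp)
    (fun x y y' => by simp only [mul_add, map_add])
    (fun c x y => by simp)
  have hE : ∀ x y, E x y = Tr (star x * y) := fun _ _ => rfl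
  have hTrp : 0 ≤ Tr p := by have := hTr p; rwa [hps, hpp] at this
  have hTrn : ‖Tr p‖ = (Tr p).re := by
    rw [← Complex.re_eq_norm] at hTrp; exact hTrp.symm
  have key : ∀ m : ℝ, 0 < m → ‖M‖ ≤ m → ‖Tr (p * M)‖ ≤ 2 * m * (Tr p).re := by
    intro m hm hMm
    have h := norm_sesq_le E hTr p (M * p) (inv_pos.2 hm)
    rw [hE, hE, hE, hps, hpp, inv_inv, hTrn] at h
    have e1 : Tr (p * (M * p)) = Tr (p * M) := by
      rw [hcomm, mul_assoc, hpp, hcomm]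
    have h2 : ‖Tr (star (M * p) * (M * p))‖ ≤ m ^ 2 * (Tr p).re := by
      have h3 : 0 ≤ ((m ^ 2 : ℝ) : ℂ) • (1 : B) - star M * M := by
        rw [sub_nonneg]
        refine (norm_le_iff_le_smul_one (star_mul_self_nonneg M) (by positivity)).1 ?_
        rw [CStarRing.norm_star_mul_self, pow_two]
        gcongr
      have h4 := trace_projection_mul_nonneg hTr hcomm hp h3
      have e2 : Tr (star (M * p) * (M * p)) = Tr (p * (star M * M)) := by
        rw [star_mul, hps, mul_assoc, hcomm, mul_assoc, mul_assoc, hpp, ← mul_assoc, hcomm]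
      have h5 := hTr (M * p)
      rw [mul_sub, map_sub, ← e2, sub_nonneg, mul_smul_comm, mul_one, map_smul] at h4
      have h6 := (Complex.le_def.1 h4).1
      rw [Complex.re_eq_norm.2 h5] at h6
      rwa [smul_eq_mul, Complex.re_ofReal_mul] at h6
    rw [e1] at h
    have h7 : 0 ≤ (Tr p).re := by rw [← hTrn]; exact norm_nonneg _
    calc _ ≤ _ := h
      _ ≤ m * (Tr p).re + m⁻¹ * (m ^ 2 * (Tr p).re) := by gcongr
      _ = _ := by field_simp; ring
  -- Letting `m` decrease to `‖M‖` covers `M = 0`, where the parameter `‖M‖⁻¹` is not available.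
  have hlim : Tendsto (fun m : ℝ => 2 * m * (Tr p).re) (𝓝[>] ‖M‖) (𝓝 (2 * ‖M‖ * (Tr p).re)) := by
    refine (Continuous.tendsto ?_ _).mono_left nhdsWithin_le_nhds
    fun_prop
  refine ge_of_tendsto hlim ?_
  filter_upwards [self_mem_nhdsWithin] with m hm
  exact key m ((norm_nonneg M).trans_lt hm) hm.le

theorem indic_mul_self (ε s : ℝ) : indic ε s * indic ε s = indic ε s := by
  unfold indic; split_ifs <;> simp

theorem isStarProjection_cfc_indic {X : B} (hfin : (spectrum ℝ X).Finite) (ε : ℝ) :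
    IsStarProjection (cfc (indic ε) X) := by
  refine ⟨?_, cfc_predicate (R := ℝ) _ X⟩
  change cfc (indic ε) X * cfc (indic ε) X = cfc (indic ε) X
  rw [← cfc_mul _ _ X (hfin.continuousOn _) (hfin.continuousOn _)]
  exact cfc_congr fun s _ => indic_mul_self ε s

/-- Comparison of the number of large eigenvalues of `X` and `Y` with the trace of functions of
`X` and `Y` weighted by a projection `p` that almost acts as a unit on `X`. -/
theorem trace_comparison [PartialOrder B] [StarOrderedRing B]
    (hTr : ∀ x, 0 ≤ Tr (star x * x)) (hcomm : ∀ x y, Tr (x * y) = Tr (y * x))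
    (hfin : ∀ X : B, (spectrum ℝ X).Finite) {p X Y : B} (hp : IsStarProjection p)
    (hX : 0 ≤ X) {ε η β : ℝ} (hε : 0 < ε) (hβ : 0 < β) (hηβ : η ≤ β)
    (hN : (Tr (cfc (indic η) Y)).re ≤ (Tr (cfc (indic ε) X)).re)
    (hθ : 2 * (‖(1 - p) * X‖ * ε⁻¹) ≤ 1) :
    (1 - 2 * (‖(1 - p) * X‖ * ε⁻¹)) * (Tr (cfc (indic ε) X)).re ≤ (Tr p).re ∧
    (1 - 2 * (‖(1 - p) * X‖ * ε⁻¹)) * (Tr (p * cfc (ramp β) Y)).re ≤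
      (Tr (p * cfc (fun s => min 1 (s / ε)) X)).re := by
  set q := cfc (indic ε) X with hq
  set θ := 2 * (‖(1 - p) * X‖ * ε⁻¹) with hθdef
  have hqp : IsStarProjection q := isStarProjection_cfc_indic (hfin X) ε
  have hqq : q * q = q := hqp.isIdempotentElem
  have hmono : ∀ {a b : B}, a ≤ b → (Tr (p * a)).re ≤ (Tr (p * b)).re := by
    intro a b hab
    have := trace_projection_mul_nonneg hTr hcomm hp (sub_nonneg.2 hab)
    rw [mul_sub, map_sub, sub_nonneg] at this
    exact (Complex.le_def.1 this).1
  -- Since `q` is a spectral projection above `ε`, it factors as `X * Z` with `‖Z‖ ≤ ε⁻¹`. So `1 -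
  -- p`, small on `X`, is small on `q`.
  have h1 : (1 - θ) * (Tr q).re ≤ (Tr (p * q)).re := by
    set Z := cfc (fun s => indic ε s * s⁻¹) X with hZ
    have hqZ : q = X * Z := by
      rw [hq, hZ]
      nth_rewrite 2 [← cfc_id' ℝ X]
      rw [← cfc_mul _ _ X (by fun_prop) ((hfin X).continuousOn _)]
      refine cfc_congr fun s _ => ?_
      unfold indic
      split_ifs with h
      · have : s ≠ 0 := by linarith
        field_simp
      · simp
    have hZn : ‖Z‖ ≤ ε⁻¹ := by
      refine norm_cfc_le (by positivity) fun s _ => ?_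
      unfold indic
      split_ifs with h
      · rw [one_mul, norm_inv, Real.norm_of_nonneg (by linarith)]
        exact inv_anti₀ hε h.le
      · simp; exact hε.le
    have h2 := norm_trace_projection_mul_le hTr hcomm hqp ((1 - p) * q)
    have e : Tr (q * ((1 - p) * q)) = Tr q - Tr (p * q) := by
      rw [hcomm, mul_assoc, hqq, sub_mul, one_mul, map_sub]
    rw [e] at h2
    have h3 : ‖(1 - p) * q‖ ≤ ‖(1 - p) * X‖ * ε⁻¹ := by
      rw [hqZ, ← mul_assoc]
      exact (norm_mul_le _ _).trans (by gcongr)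
    have h4 : 0 ≤ (Tr q).re := by
      have := hTr q
      rw [hqp.isSelfAdjoint.star_eq, hqq] at this
      exact (Complex.le_def.1 this).1
    have h5 := (Complex.re_le_norm _).trans h2
    rw [Complex.sub_re] at h5
    have h6 : 2 * ‖(1 - p) * q‖ * (Tr q).re ≤ θ * (Tr q).re := by
      rw [hθdef]
      gcongr
    linarith
  have hq1 : q ≤ 1 := by
    refine cfc_le_one _ _ fun s _ => ?_
    unfold indic; split_ifs <;> norm_num
  have hqf : q ≤ cfc (fun s => min 1 (s / ε)) X := by
    refine cfc_mono (fun s hs => ?_) ((hfin X).continuousOn _) ((hfin X).continuousOn _)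
    have hs0 : 0 ≤ s := spectrum_nonneg_of_nonneg hX hs
    unfold indic
    split_ifs with h
    · exact le_min le_rfl ((one_le_div hε).2 h.le)
    · exact le_min zero_le_one (by positivity)
  refine ⟨h1.trans ?_, ?_⟩
  · have := hmono hq1
    rwa [mul_one] at this
  -- The chain is `Tr (p ramp Y) ≤ Tr (ramp Y) ≤ Tr (indic η Y) ≤ Tr q`, where the second step uses
  -- `η ≤ β`.
  refine le_trans ?_ (h1.trans (hmono hqf))
  refine mul_le_mul_of_nonneg_left ?_ (by linarith)
  refine le_trans ?_ hN
  have hr0 : 0 ≤ cfc (ramp β) Y := cfc_nonneg fun s _ => ramp_nonneg β s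
  have h7 := trace_projection_mul_nonneg hTr hcomm hp.one_sub hr0
  rw [sub_mul, one_mul, map_sub, sub_nonneg] at h7
  have h8 : cfc (ramp β) Y ≤ cfc (indic η) Y := by
    refine cfc_mono (fun s hs => ?_) ((hfin Y).continuousOn _) ((hfin Y).continuousOn _)
    unfold indic
    split_ifs with h
    · exact ramp_le_one β s
    · rw [ramp_eq_zero hβ (by linarith)]
  have h9 := trace_projection_mul_nonneg hTr hcomm (IsStarProjection.one (R := B)) (sub_nonneg.2 h8)
  rw [one_mul, map_sub, sub_nonneg] at h9
  exact (Complex.le_def.1 (h7.trans h9)).1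

/-- The spectral projection of an almost idempotent positive contraction. -/
theorem norm_cfc_indic_sub_le {h : B} [PartialOrder B] [StarOrderedRing B] (hh : 0 ≤ h)
    (hh1 : ‖h‖ ≤ 1) (hfin : (spectrum ℝ h).Finite) :
    ‖cfc (indic (1 / 2)) h - h‖ ≤ 2 * ‖h - h * h‖ := by
  have e1 : h - h * h = cfc (fun s : ℝ => s - s * s) h := by
    rw [cfc_sub (fun s : ℝ => s) (fun s => s * s) h, cfc_mul (fun s : ℝ => s) (fun s => s) h,
      cfc_id' ℝ h]
  have e2 : cfc (indic (1 / 2)) h - h = cfc (fun s => indic (1 / 2) s - s) h := by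
    rw [cfc_sub (indic (1 / 2)) (fun s : ℝ => s) h (hfin.continuousOn _) (by fun_prop),
      cfc_id' ℝ h]
  rw [e2]
  refine norm_cfc_le (by positivity) fun s hs => ?_
  have hs0 : 0 ≤ s := spectrum_nonneg_of_nonneg hh hs
  have hs1 : s ≤ 1 := ((le_algebraMap_iff_spectrum_le (R := ℝ) (hh.isSelfAdjoint)).1
    hh.isSelfAdjoint.le_algebraMap_norm_self s hs).trans hh1
  have h2 := norm_apply_le_norm_cfc (fun s : ℝ => s - s * s) h hs
  rw [← e1, Real.norm_of_nonneg (by nlinarith)] at h2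
  refine le_trans ?_ (mul_le_mul_of_nonneg_left h2 zero_le_two)
  -- On `[0, 1]` the distance of `s` to its rounding at `1/2` is at most `2 s (1 - s)`, as one of
  -- the factors `s` and `1 - s` is at least `1/2`.
  rw [Real.norm_eq_abs, abs_le]
  unfold indic
  split_ifs with h3 <;> constructor <;> nlinarith

end

/-! ### Limit traces along an ultrafilter -/

section
variable {A : Type*} [CStarAlgebra A] [PartialOrder A] [StarOrderedRing A]
  {ι : Type*} {U : Ultrafilter ι} {B : ι → Type*} [∀ i, CStarAlgebra (B i)]
  [∀ i, PartialOrder (B i)] [∀ i, StarOrderedRing (B i)]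

/-- Weighted traces of an asymptotically multiplicative family of positive maps converge along an
ultrafilter to a tracial state. -/
theorem exists_tracialState_tendsto (ψ : ∀ i, A →ₗ[ℂ] B i)
    (hpos : ∀ i x, 0 ≤ x → 0 ≤ ψ i x) (hnorm : ∀ i x, ‖ψ i x‖ ≤ ‖x‖)
    (hmul : ∀ x y, Tendsto (fun i => ‖ψ i (x * y) - ψ i x * ψ i y‖) U (𝓝 0))
    (Tr : ∀ i, B i →ₗ[ℂ] ℂ) (hTr : ∀ i x, 0 ≤ Tr i (star x * x))
    (hcomm : ∀ i x y, Tr i (x * y) = Tr i (y * x)) (p : ∀ i, B i)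
    (hp : ∀ i, IsStarProjection (p i)) (hTrp : ∀ᶠ i in U, 0 < (Tr i (p i)).re)
    (hpψ : ∀ x, Tendsto (fun i => ‖(1 - p i) * ψ i x‖) U (𝓝 0))
    (hp1 : Tendsto (fun i => ‖p i - ψ i 1‖) U (𝓝 0)) :
    ∃ τ : TracialState A, ∀ x, Tendsto (fun i => Tr i (p i * ψ i x) / Tr i (p i)) U
      (𝓝 (τ.toPositiveLinearMap x)) := by
  have hreal : ∀ i, Tr i (p i) = ((Tr i (p i)).re : ℂ) := by
    intro i
    have h := hTr i (p i)
    rw [(hp i).isSelfAdjoint.star_eq, show p i * p i = p i from (hp i).isIdempotentElem] at h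
    exact Complex.ext rfl (by simpa using (Complex.le_def.1 h).2.symm)
  have hbound : ∀ᶠ i in U, ∀ M, ‖Tr i (p i * M) / Tr i (p i)‖ ≤ 2 * ‖M‖ := by
    filter_upwards [hTrp] with i hi M
    rw [norm_div, hreal i, Complex.norm_of_nonneg hi.le, div_le_iff₀ hi]
    exact norm_trace_projection_mul_le (hTr i) (hcomm i) (hp i) M
  -- The values eventually lie in a compact disc, so they converge along the ultrafilter.
  have hex : ∀ x, ∃ c : ℂ, Tendsto (fun i => Tr i (p i * ψ i x) / Tr i (p i)) U (𝓝 c) := by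
    intro x
    obtain ⟨c, -, hc⟩ := (isCompact_closedBall (0 : ℂ) (2 * ‖x‖)).ultrafilter_le_nhds
      (U.map fun i => Tr i (p i * ψ i x) / Tr i (p i)) (by
        rw [le_principal_iff]
        change ∀ᶠ i in (U : Filter ι), _
        filter_upwards [hbound] with i hi
        rw [mem_closedBall_zero_iff]
        refine (hi _).trans ?_
        gcongr
        exact hnorm i x)
    exact ⟨c, hc⟩
  choose L hL using hex
  have hlim : ∀ {x : A} {g : ι → ℂ} {c : ℂ}, Tendsto g U (𝓝 c) →
      (∀ᶠ i in U, ‖Tr i (p i * ψ i x) / Tr i (p i) - g i‖ ≤ 0) → L x = c := by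
    intro x g c hg h
    refine tendsto_nhds_unique (hL x) (hg.congr' ?_)
    filter_upwards [h] with i hi
    exact (sub_eq_zero.1 (norm_le_zero_iff.1 hi)).symm
  have hadd : ∀ x y, L (x + y) = L x + L y := fun x y =>
    hlim ((hL x).add (hL y)) (Eventually.of_forall fun i => by
      rw [map_add, mul_add, map_add, add_div, sub_self, norm_zero])
  have hsmul : ∀ (c : ℂ) x, L (c • x) = c • L x := fun c x =>
    hlim ((hL x).const_smul c) (Eventually.of_forall fun i => by
      rw [map_smul, mul_smul_comm, map_smul, smul_eq_mul, smul_eq_mul, mul_div_assoc, sub_self,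
        norm_zero])
  have hLpos : ∀ x, 0 ≤ x → 0 ≤ L x := by
    intro x hx
    refine ge_of_tendsto (hL x) ?_
    filter_upwards [hTrp] with i hi
    have h1 := trace_projection_mul_nonneg (hTr i) (hcomm i) (hp i) (hpos i x hx)
    rw [hreal i]
    rw [← Complex.ofReal_zero, Complex.le_def] at *
    rw [Complex.div_ofReal_re, Complex.div_ofReal_im, ← h1.2]
    simp only [Complex.ofReal_re, Complex.ofReal_im, zero_div, and_true] at h1 ⊢
    exact div_nonneg h1.1 hi.le
  have hsmall : ∀ {x : A} {c : ℂ} {g : ι → ℂ} {e : ι → ℝ}, Tendsto g U (𝓝 c) →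
      Tendsto e U (𝓝 0) → (∀ᶠ i in U, ‖Tr i (p i * ψ i x) / Tr i (p i) - g i‖ ≤ e i) →
      L x = c := by
    intro x c g e hg he h
    have h1 := (hL x).sub hg
    have h2 : Tendsto (fun i => Tr i (p i * ψ i x) / Tr i (p i) - g i) U (𝓝 0) :=
      squeeze_zero_norm' h he
    exact sub_eq_zero.1 (tendsto_nhds_unique h1 h2)
  have hone : L 1 = 1 := by
    refine hsmall (g := fun _ => 1) (e := fun i => 2 * ‖p i - ψ i 1‖) tendsto_const_nhds
      (by simpa using hp1.const_mul 2) ?_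
    filter_upwards [hTrp, hbound] with i hi hb
    have h0 : Tr i (p i) ≠ 0 := by rw [hreal i]; exact_mod_cast hi.ne'
    have e1 : Tr i (p i * ψ i 1) / Tr i (p i) - 1 =
        -(Tr i (p i * (p i - ψ i 1)) / Tr i (p i)) := by
      rw [mul_sub, show p i * p i = p i from (hp i).isIdempotentElem, map_sub]
      field_simp
      ring
    rw [e1, norm_neg]
    exact hb _
  have htr : ∀ x y, L (x * y) = L (y * x) := by
    intro x y
    refine hsmall (hL (y * x)) (e := fun i => 2 * ‖ψ i (x * y) - ψ i x * ψ i y‖ +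
      2 * (‖x‖ * ‖(1 - p i) * ψ i y‖) + 2 * (‖y‖ * ‖(1 - p i) * ψ i x‖) +
      2 * ‖ψ i (y * x) - ψ i y * ψ i x‖) ?_ ?_
    · simpa using ((((hmul x y).const_mul 2).add (((hpψ y).const_mul ‖x‖).const_mul 2)).add
        (((hpψ x).const_mul ‖y‖).const_mul 2)).add ((hmul y x).const_mul 2)
    · filter_upwards [hTrp, hbound] with i hi hb
      have hpp : p i * p i = p i := (hp i).isIdempotentElem
      have h1 := hb (ψ i (x * y) - ψ i x * ψ i y)
      have h2 := hb (ψ i x * ((1 - p i) * ψ i y))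
      have h3 := hb (ψ i y * ((1 - p i) * ψ i x))
      have h4 := hb (ψ i (y * x) - ψ i y * ψ i x)
      have hn : ∀ u v : A, 2 * ‖ψ i u * ((1 - p i) * ψ i v)‖ ≤
          2 * (‖u‖ * ‖(1 - p i) * ψ i v‖) := by
        intro u v
        gcongr
        exact (norm_mul_le _ _).trans (by gcongr; exact hnorm i u)
      -- `Tr (p ·)` is not tracial, but with a second `p` inserted between the factors the
      -- expression is symmetric in `x` and `y`. The insertion costs a multiple of `‖(1 - p) ψ y‖`
      -- or `‖(1 - p) ψ x‖`.
      have e1 : Tr i (p i * (ψ i x * (p i * ψ i y))) = Tr i (p i * (ψ i y * (p i * ψ i x))) := by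
        rw [← mul_assoc (p i) (ψ i x), hcomm i _ (p i * ψ i y), mul_assoc]
      have e2 : Tr i (p i * ψ i (x * y)) - Tr i (p i * ψ i (y * x)) =
          Tr i (p i * (ψ i (x * y) - ψ i x * ψ i y)) +
          Tr i (p i * (ψ i x * ((1 - p i) * ψ i y))) -
          Tr i (p i * (ψ i y * ((1 - p i) * ψ i x))) -
          Tr i (p i * (ψ i (y * x) - ψ i y * ψ i x)) := by
        simp only [mul_sub, sub_mul, one_mul, map_sub]
        rw [e1]
        ring
      rw [← sub_div, e2, sub_div, sub_div, add_div]
      refine (norm_sub_le _ _).trans (add_le_add ((norm_sub_le _ _).trans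
        (add_le_add ((norm_add_le _ _).trans (add_le_add h1 (h2.trans (hn x y)))) ?_)) h4)
      exact h3.trans (hn y x)
  let T : A →ₗ[ℂ] ℂ := { toFun := L, map_add' := hadd, map_smul' := hsmul }
  exact ⟨{ PositiveLinearMap.mk₀ T hLpos with
    map_one' := hone
    map_mul_comm' := htr }, hL⟩

end

/-! ### Continuous bounds for dimension functions -/

namespace TracialState
variable {A : Type*} [CStarAlgebra A] [PartialOrder A] [StarOrderedRing A] (τ : TracialState A)

theorem re_mono {x y : A} (h : x ≤ y) :
    (τ.toPositiveLinearMap x).re ≤ (τ.toPositiveLinearMap y).re :=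
  (Complex.le_def.1 (OrderHomClass.mono τ.toPositiveLinearMap h)).1

theorem re_smul (c : ℝ) (x : A) :
    (τ.toPositiveLinearMap (c • x)).re = c * (τ.toPositiveLinearMap x).re := by
  rw [← Complex.coe_smul, map_smul, smul_eq_mul, Complex.re_ofReal_mul]

theorem re_one : (τ.toPositiveLinearMap 1).re = 1 := by
  have : τ.toPositiveLinearMap 1 = 1 := τ.map_one'
  rw [this, Complex.one_re]

theorem tendsto_rpow_one_div {c : ℝ} (hc : 0 < c) :
    Tendsto (fun k : ℕ => c ^ (1 / (k : ℝ))) atTop (𝓝 1) := by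
  have h2 := (Real.continuous_const_rpow hc.ne').tendsto 0
  rw [Real.rpow_zero] at h2
  exact h2.comp tendsto_one_div_atTop_nhds_zero_nat

/-- Pointwise `min 1 (s / ε) ≤ (s / ε)^{1/k}`, and the factor `ε^{-1/k}` tends to one. -/
theorem re_min_one_le_dimFun {a : A} (ha : 0 ≤ a) {ε : ℝ} (hε : 0 < ε) :
    (τ.toPositiveLinearMap (cfc (fun s => min 1 (s / ε)) a)).re ≤ τ.dimFun a := by
  have h1 := (tendsto_rpow_one_div (inv_pos.2 hε)).mul (τ.tendsto_dimFun a)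
  rw [one_mul] at h1
  refine ge_of_tendsto h1 ?_
  filter_upwards [eventually_gt_atTop 0] with k hk
  have hk0 : 0 < 1 / (k : ℝ) := by positivity
  have hk1 : 1 / (k : ℝ) ≤ 1 := by
    rw [div_le_one (by exact_mod_cast hk)]; exact_mod_cast hk
  rw [← re_smul]
  refine τ.re_mono ?_
  rw [CFC.rpow_eq_cfc_real ha, ← cfc_smul _ _ a
    (by exact (Real.continuous_rpow_const hk0.le).continuousOn)]
  refine cfc_mono (fun s hs => ?_) (by fun_prop) (by
    exact ((Real.continuous_rpow_const hk0.le).const_smul (ε⁻¹ ^ (1 / (k : ℝ)))).continuousOn)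
  have hs0 : 0 ≤ s := spectrum_nonneg_of_nonneg ha hs
  rw [smul_eq_mul, ← Real.mul_rpow (inv_nonneg.2 hε.le) hs0, mul_comm, ← div_eq_mul_inv]
  have hu : 0 ≤ s / ε := by positivity
  rcases le_total (s / ε) 1 with h | h
  · exact (min_le_right _ _).trans (Real.self_le_rpow_of_le_one hu h hk1)
  · exact (min_le_left _ _).trans (Real.one_le_rpow h hk0.le)

/-- Pointwise on the spectrum, `s^{1/k} ≤ M^{1/k} ramp β s + (2β)^{1/k}`. First `β → 0` for fixed
`k`, then `k → ∞`; the summand `1` in `M` keeps the base positive when `d = 0`. -/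
theorem dimFun_le {d : A} (hd : 0 ≤ d) {t : ℝ}
    (h : ∀ β : ℝ, 0 < β → (τ.toPositiveLinearMap (cfc (ramp β) d)).re ≤ t) :
    τ.dimFun d ≤ t := by
  set M := ‖d‖ + 1 with hM
  have hM0 : 0 < M := by positivity
  have h1 := (tendsto_rpow_one_div hM0).mul_const t
  rw [one_mul] at h1
  refine le_of_tendsto_of_tendsto (τ.tendsto_dimFun d) h1 ?_
  filter_upwards [eventually_gt_atTop 0] with k hk
  have hk0 : 0 < 1 / (k : ℝ) := by positivity
  have hlim : Tendsto (fun β : ℝ => M ^ (1 / (k : ℝ)) * t + (2 * β) ^ (1 / (k : ℝ))) (𝓝[>] 0)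
      (𝓝 (M ^ (1 / (k : ℝ)) * t + (2 * 0) ^ (1 / (k : ℝ)))) := by
    refine (Continuous.tendsto ?_ 0).mono_left nhdsWithin_le_nhds
    exact continuous_const.add ((Real.continuous_rpow_const hk0.le).comp (by fun_prop))
  rw [mul_zero, Real.zero_rpow hk0.ne', add_zero] at hlim
  refine ge_of_tendsto hlim ?_
  filter_upwards [self_mem_nhdsWithin] with β hβ
  have hβ0 : 0 < β := hβ
  have hle : d ^ (1 / (k : ℝ)) ≤
      M ^ (1 / (k : ℝ)) • cfc (ramp β) d + (2 * β) ^ (1 / (k : ℝ)) • 1 := by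
    have hr : ContinuousOn (ramp β) (spectrum ℝ d) := (continuous_ramp β).continuousOn
    rw [CFC.rpow_eq_cfc_real hd, ← cfc_smul _ _ d hr, ← Algebra.algebraMap_eq_smul_one,
      ← cfc_add_const _ (fun x => M ^ (1 / (k : ℝ)) • ramp β x) d
        (by exact hr.const_smul (M ^ (1 / (k : ℝ))))]
    refine cfc_mono (fun s hs => ?_) (by exact (Real.continuous_rpow_const hk0.le).continuousOn)
      (by exact (hr.const_smul (M ^ (1 / (k : ℝ)))).add continuousOn_const)
    have hs0 : 0 ≤ s := spectrum_nonneg_of_nonneg hd hs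
    have hs1 : s ≤ ‖d‖ := (le_algebraMap_iff_spectrum_le (R := ℝ) (hd.isSelfAdjoint)).1
      hd.isSelfAdjoint.le_algebraMap_norm_self s hs
    rw [smul_eq_mul]
    rcases le_total (2 * β) s with h2 | h2
    · rw [ramp_eq_one hβ0 h2, mul_one]
      have h3 : s ^ (1 / (k : ℝ)) ≤ M ^ (1 / (k : ℝ)) :=
        Real.rpow_le_rpow hs0 (by rw [hM]; linarith) hk0.le
      have h4 : 0 ≤ (2 * β) ^ (1 / (k : ℝ)) := by positivity
      linarith
    · have h3 : s ^ (1 / (k : ℝ)) ≤ (2 * β) ^ (1 / (k : ℝ)) := Real.rpow_le_rpow hs0 h2 hk0.le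
      have h4 : 0 ≤ M ^ (1 / (k : ℝ)) * ramp β s :=
        mul_nonneg (by positivity) (ramp_nonneg _ _)
      linarith
  have h5 := τ.re_mono hle
  rw [map_add, Complex.add_re, re_smul, re_smul, re_one, mul_one] at h5
  refine h5.trans ?_
  gcongr
  exact h β hβ0

end TracialState

/-! ### From tracial comparison to comparison in matrix summands -/

section
variable {A : Type*} [CStarAlgebra A] [PartialOrder A] [StarOrderedRing A]

/-- A family of asymptotically multiplicative maps into matrix algebras under which `d` has fewer
large eigenvalues than `a` yields a tracial state `τ` with `d_τ(d) ≤ d_τ(a)`. -/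
theorem exists_tracialState_dimFun_le [Nontrivial A] {ι : Type*} {U : Ultrafilter ι}
    {B : ι → Type*} [∀ i, CStarAlgebra (B i)]
    [∀ i, PartialOrder (B i)] [∀ i, StarOrderedRing (B i)]
    (hfin : ∀ i, ∀ X : B i, (spectrum ℝ X).Finite)
    (Tr : ∀ i, B i →ₗ[ℂ] ℂ) (hTr : ∀ i x, 0 ≤ Tr i (star x * x))
    (hcomm : ∀ i x y, Tr i (x * y) = Tr i (y * x))
    (ψ : ∀ i, A →ₗ[ℂ] B i)
    (hpos : ∀ i x, 0 ≤ x → 0 ≤ ψ i x) (hnorm : ∀ i x, ‖ψ i x‖ ≤ ‖x‖)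
    (hS : ∀ i x, star (ψ i x) * ψ i x ≤ ψ i (star x * x))
    (hD : ∀ x, Tendsto (fun i => ‖ψ i (star x * x) - star (ψ i x) * ψ i x‖) U (𝓝 0))
    {a d : A} (ha : 0 ≤ a) (hd : 0 ≤ d) {ε : ℝ} (hε : 0 < ε) {η : ι → ℝ}
    (hη : Tendsto η U (𝓝 0))
    (hN : ∀ i, (Tr i (cfc (indic (η i)) (ψ i d))).re < (Tr i (cfc (indic ε) (ψ i a))).re) :
    ∃ τ : TracialState A, τ.dimFun d ≤ τ.dimFun a := by
  have hstar : ∀ i x, ψ i (star x) = star (ψ i x) := fun i x =>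
    map_star (PositiveLinearMap.mk₀ (ψ i) (hpos i)) x
  have hmul := tendsto_norm_map_mul_sub ψ hstar hnorm hS hD
  have h10 : ∀ i, 0 ≤ ψ i 1 := fun i => hpos i 1 zero_le_one
  have h1n : ∀ i, ‖ψ i 1‖ ≤ 1 := fun i => by simpa using hnorm i 1
  -- The maps need not be unital, but `ψ 1` is almost idempotent. Its spectral projection is
  -- therefore an approximate unit for the image, and normalizing by `Tr p` gives a limit functional
  -- of total mass one.
  set p : ∀ i, B i := fun i => cfc (indic (1 / 2)) (ψ i 1) with hpdef
  have hp : ∀ i, IsStarProjection (p i) := fun i => isStarProjection_cfc_indic (hfin i _) _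
  have hp1 : Tendsto (fun i => ‖p i - ψ i 1‖) U (𝓝 0) := by
    have h := (hmul 1 1).const_mul 2
    rw [mul_zero] at h
    refine squeeze_zero (fun _ => norm_nonneg _) (fun i => ?_) h
    rw [mul_one]
    exact norm_cfc_indic_sub_le (h10 i) (h1n i) (hfin i _)
  have hpψ : ∀ x, Tendsto (fun i => ‖(1 - p i) * ψ i x‖) U (𝓝 0) := by
    intro x
    have h := (hmul 1 x).add (hp1.mul_const ‖x‖)
    rw [zero_mul, add_zero] at h
    refine squeeze_zero (fun _ => norm_nonneg _) (fun i => ?_) h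
    rw [one_mul]
    have e : (1 - p i) * ψ i x = (ψ i x - ψ i 1 * ψ i x) - (p i - ψ i 1) * ψ i x := by
      noncomm_ring
    rw [e]
    refine (norm_sub_le _ _).trans ?_
    gcongr
    exact (norm_mul_le _ _).trans (by gcongr; exact hnorm i x)
  set θ : ι → ℝ := fun i => 2 * (‖(1 - p i) * ψ i a‖ * ε⁻¹) with hθdef
  have hθ : Tendsto θ U (𝓝 0) := by
    have := ((hpψ a).mul_const ε⁻¹).const_mul 2
    simpa using this
  have hθ1 : ∀ᶠ i in (U : Filter ι), θ i < 1 := hθ.eventually_lt_const one_pos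
  have hcmp : ∀ i β, 0 < β → η i ≤ β → θ i < 1 → _ := fun i β hβ hηβ h1 =>
    trace_comparison (hTr i) (hcomm i) (hfin i) (hp i) (hpos i a ha) (Y := ψ i d) hε hβ hηβ
      (hN i).le h1.le
  -- Strictness in `hN` is needed here: it gives `a` at least one large eigenvalue, so that division
  -- by `Tr p` is possible.
  have hTrp : ∀ᶠ i in (U : Filter ι), 0 < (Tr i (p i)).re := by
    filter_upwards [hθ1, hη.eventually_lt_const one_pos] with i h1 h2
    refine lt_of_lt_of_le (mul_pos (sub_pos.2 h1) (lt_of_le_of_lt ?_ (hN i)))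
      (hcmp i 1 one_pos h2.le h1).1
    have hq : IsStarProjection (cfc (indic (η i)) (ψ i d)) := isStarProjection_cfc_indic (hfin i _) _
    have h := hTr i (cfc (indic (η i)) (ψ i d))
    rw [hq.isSelfAdjoint.star_eq, hq.isIdempotentElem.eq] at h
    exact (Complex.le_def.1 h).1
  obtain ⟨τ, hτ⟩ := exists_tracialState_tendsto ψ hpos hnorm hmul Tr hTr hcomm p hp hTrp hpψ hp1
  refine ⟨τ, τ.dimFun_le hd fun β hβ => ?_⟩
  refine le_trans ?_ (τ.re_min_one_le_dimFun ha hε)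
  have hreal : ∀ i, Tr i (p i) = ((Tr i (p i)).re : ℂ) := by
    intro i
    have h := hTr i (p i)
    rw [(hp i).isSelfAdjoint.star_eq, (hp i).isIdempotentElem.eq] at h
    exact Complex.ext rfl (by simpa using (Complex.le_def.1 h).2.symm)
  have hτf : ∀ {x : A}, 0 ≤ x → ∀ {f : ℝ → ℝ}, Continuous f → f 0 = 0 →
      Tendsto (fun i => (Tr i (p i * cfc f (ψ i x))).re / (Tr i (p i)).re) U
        (𝓝 (τ.toPositiveLinearMap (cfc f x)).re) := by
    intro x hx f hf hf0
    have h1 := (Complex.continuous_re.tendsto _).comp (hτ (cfc f x))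
    have h2 := tendsto_norm_map_cfc_sub ψ hnorm hmul hpos hx hf hf0
    have h3 : Tendsto (fun i => (Tr i (p i * (ψ i (cfc f x) - cfc f (ψ i x)))).re /
        (Tr i (p i)).re) U (𝓝 0) := by
      refine squeeze_zero_norm' ?_ (by simpa using h2.const_mul 2)
      filter_upwards [hTrp] with i hi
      rw [norm_div, Real.norm_of_nonneg hi.le, div_le_iff₀ hi]
      exact (Complex.abs_re_le_norm _).trans
        (norm_trace_projection_mul_le (hTr i) (hcomm i) (hp i) _)
    have h4 := h1.sub h3
    rw [sub_zero] at h4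
    refine h4.congr fun i => ?_
    simp only [Function.comp_apply]
    rw [hreal i, Complex.div_ofReal_re, Complex.ofReal_re, mul_sub, map_sub, Complex.sub_re]
    ring
  have hA := hτf ha (f := fun s => min 1 (s / ε)) (by fun_prop) (by simp)
  have hDd := hτf hd (continuous_ramp β) (ramp_eq_zero hβ hβ.le)
  have hDd' := ((tendsto_const_nhds (x := (1 : ℝ))).sub hθ).mul hDd
  rw [sub_zero, one_mul] at hDd'
  refine le_of_tendsto_of_tendsto hDd' hA ?_
  filter_upwards [hθ1, hη.eventually_lt_const hβ, hTrp] with i h1 h2 h3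
  rw [← mul_div_assoc]
  gcongr
  exact (hcmp i β hβ h2.le h1).2

theorem StarAlgEquiv.finite_real_spectrum {n : ℕ} {B : Type*} [CStarAlgebra B]
    (Φ : Matrix (Fin n) (Fin n) ℂ ≃⋆ₐ[ℂ] B) (X : B) : (spectrum ℝ X).Finite := by
  have h : spectrum ℝ X = spectrum ℝ (Φ.symm X) := by
    ext c
    rw [← spectrum.algebraMap_mem_iff ℂ, ← spectrum.algebraMap_mem_iff (R := ℝ) ℂ,
      AlgEquiv.spectrum_eq Φ.symm]
  rw [h]
  exact Matrix.finite_real_spectrum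

/-- If `d_τ(a) < d_τ(d)` for all tracial states, then every sufficiently multiplicative map into a
matrix algebra sends `d` to an element with at least as many large eigenvalues as the image
of `a`. -/
theorem exists_finset_comparison [Nontrivial A] {a d : A} (ha : 0 ≤ a) (hd : 0 ≤ d)
    (hlt : ∀ τ : TracialState A, τ.dimFun a < τ.dimFun d) {ε : ℝ} (hε : 0 < ε) :
    ∃ (G : Finset A) (η : ℝ), 0 < η ∧
      ∀ (n : ℕ) (ψ : A →ₗ[ℂ] CStarMatrix (Fin n) (Fin n) ℂ),
        (∀ x, 0 ≤ x → 0 ≤ ψ x) → (∀ x, ‖ψ x‖ ≤ ‖x‖) →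
        (∀ x, star (ψ x) * ψ x ≤ ψ (star x * x)) →
        (∀ b ∈ G, ‖ψ (star b * b) - star (ψ b) * ψ b‖ ≤ η) →
        ∃ v : CStarMatrix (Fin n) (Fin n) ℂ, v * star v ≤ ψ a ∧ ψ a ≤ v * star v + (ε : ℂ) • 1 ∧
          (η : ℂ) • (v * star v) ≤ v * ψ d * star v := by
  classical
  -- Counterexamples are indexed by a finite set together with a tolerance `1 / (k + 1)`. Along an
  -- ultrafilter finer than `atTop` they are asymptotically multiplicative on all of `A`, with no
  -- bound on the matrix sizes.
  by_contra! hcon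
  have hpos : ∀ i : Finset A × ℕ, (0 : ℝ) < 1 / ((i.2 : ℝ) + 1) := fun i => by positivity
  choose n ψ h1 h2 h3 h4 h5 using fun i : Finset A × ℕ => hcon i.1 _ (hpos i)
  let Φ := fun i => CStarMatrix.ofMatrixStarAlgEquiv (n := Fin (n i)) (A := ℂ)
  let U : Ultrafilter (Finset A × ℕ) := Ultrafilter.of atTop
  have hU : (U : Filter (Finset A × ℕ)) ≤ atTop := Ultrafilter.of_le _
  have hη : Tendsto (fun i : Finset A × ℕ => 1 / ((i.2 : ℝ) + 1)) atTop (𝓝 0) := by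
    have : Tendsto (fun i : Finset A × ℕ => i.2) atTop atTop := by
      rw [← prod_atTop_atTop_eq]; exact tendsto_snd
    exact tendsto_one_div_add_atTop_nhds_zero_nat.comp this
  obtain ⟨τ, hτ⟩ := exists_tracialState_dimFun_le (U := U)
    (B := fun i => CStarMatrix (Fin (n i)) (Fin (n i)) ℂ)
    (fun i X => (Φ i).finite_real_spectrum X)
    (fun i => (Matrix.traceLinearMap (Fin (n i)) ℂ ℂ).comp (Φ i).symm.toAlgEquiv.toLinearMap)
    (fun i x => (Matrix.posSemidef_conjTranspose_mul_self (CStarMatrix.ofMatrix.symm x)).trace_nonneg)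
    (fun i x y => Matrix.trace_mul_comm (CStarMatrix.ofMatrix.symm x) (CStarMatrix.ofMatrix.symm y))
    ψ h1 h2 h3 (fun x => by
      refine squeeze_zero' (Eventually.of_forall fun _ => norm_nonneg _) ?_ (hη.mono_left hU)
      refine hU ?_
      filter_upwards [eventually_ge_atTop (({x}, 0) : Finset A × ℕ)] with i hi
      exact h4 i x (hi.1 (Finset.mem_singleton_self x)))
    ha hd hε (hη.mono_left hU) (fun i => by
      -- If `a` did not have strictly more large eigenvalues than `d`, comparison of matrices would
      -- supply the `v` that the counterexample excludes.
      by_contra! hle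
      obtain ⟨v, hv1, hv2, hv3⟩ := exists_conj_of_trace_le (Φ i) (h1 i a ha) (h1 i d hd) hε.le hle
      exact h5 i v hv1 hv2 hv3)
  exact absurd (hlt τ) hτ.not_gt

end

/-! ### Assembly over colours and summands -/

theorem sum_mem_closure_range {A : Type*} [CStarAlgebra A] {n : ℕ} {d z : Fin n → A}
    (hz : ∀ i, z i ∈ closure (Set.range fun w : A => w * d i * star w)) :
    ∑ i, z i ∈ closure (Set.range fun v : Fin n → A => ∑ i, v i * d i * star (v i)) := by
  have h : z ∈ closure (Set.pi Set.univ fun i => Set.range fun w : A => w * d i * star w) := by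
    rw [closure_pi_set]
    exact fun i _ => hz i
  refine map_mem_closure (f := fun z : Fin n → A => ∑ i, z i) (by fun_prop) h ?_
  intro y hy
  choose w hw using fun i => hy i (Set.mem_univ i)
  exact ⟨w, by simp only [hw]⟩

section
variable {F A : Type*} [CStarAlgebra F] [PartialOrder F] [StarOrderedRing F]
  [CStarAlgebra A] [PartialOrder A] [StarOrderedRing A]

theorem CompletelyPositiveMap.map_one_le_one (φ : F →CP A) (hφ : ∀ x, ‖φ x‖ ≤ ‖x‖) :
    φ 1 ≤ 1 := by
  -- `F` may be the zero algebra, so only the inequality is available.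
  have h1 : ‖(1 : F)‖ ≤ 1 := by
    have h := CStarRing.norm_star_mul_self (x := (1 : F))
    rw [star_one, one_mul] at h
    nlinarith [norm_nonneg (1 : F)]
  have h := (CStarAlgebra.norm_le_iff_le_algebraMap (φ 1) zero_le_one
    (map_nonneg φ zero_le_one)).1 ((hφ 1).trans h1)
  rwa [map_one (algebraMap ℝ A)] at h

/-- On a colour class, the image of `v * star v` is close to being Cuntz below `d` if the image
of `y` is almost below `d` and `v * y * star v` dominates a multiple of `v * star v`. -/
theorem CompletelyPositiveMap.exists_mem_closure_norm_sub_le (φ : F →CP A) {p : F}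
    (hp : IsStarProjection p) (hc : ∀ x, p * x = x * p)
    (hcomm : ∀ x, p * x = x → Commute (φ p) (φ x))
    (hmul : ∀ x y, p * x = x → p * y = y → φ x * φ y = φ p * φ (x * y))
    {v y : F} (hv : p * v = v) (hy : p * y = y) {η δ γ : ℝ} (hγ : 0 < γ) (hη : 0 < η)
    (hδ : 0 ≤ δ) (hδη : δ < η * γ)
    (hvy : (η : ℂ) • (v * star v) ≤ v * y * star v) {d : A} (hd : φ y ≤ d + algebraMap ℝ A δ)
    {C : ℝ} (hC : 0 ≤ C) (hvC : v * star v ≤ (C : ℂ) • p) :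
    ∃ z ∈ closure (Set.range fun w : A => w * d * star w), ‖φ (v * star v) - z‖ ≤ 2 * γ * C := by
  rw [Complex.coe_smul] at hvy
  refine ⟨_, φ.ramp_mul_mem_closure hp hc hcomm hmul hv hy hγ hη hδ hδη hvy hd,
    norm_sub_ramp_mul_mul_ramp_le (map_nonneg φ (mul_star_self_nonneg v)) (map_nonneg φ hp.nonneg)
      hC ?_ (hcomm _ (by rw [← mul_assoc, hv])) hγ⟩
  have := OrderHomClass.mono φ hvC
  rwa [map_smul, Complex.coe_smul] at this

end

section
variable {A : Type*} [CStarAlgebra A] [PartialOrder A] [StarOrderedRing A]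
  {s m : ℕ} {r : Fin s → ℕ}

theorem le_norm_smul_one {B : Type*} [CStarAlgebra B] [PartialOrder B] [StarOrderedRing B]
    {x : B} (hx : 0 ≤ x) {C : ℝ} (hC : ‖x‖ ≤ C) : x ≤ (C : ℂ) • 1 :=
  (norm_le_iff_le_smul_one hx ((norm_nonneg x).trans hC)).1 hC

theorem ofReal_smul_mono {B : Type*} [CStarAlgebra B] [PartialOrder B] [StarOrderedRing B]
    {x : B} (hx : 0 ≤ x) {α β : ℝ} (h : α ≤ β) : (α : ℂ) • x ≤ (β : ℂ) • x := by
  rw [Complex.coe_smul, Complex.coe_smul]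
  exact smul_le_smul_of_nonneg_right h hx

/-- A decomposable approximation of `a`, together with comparison of `a` and `d j` in the good
summands of colour `j`, yields an approximation of `a` by elements `∑ j, v j * d j * star (v j)`. -/
theorem exists_mem_closure_sum_conj (ψ : A →CP MatrixSum r) (φ : MatrixSum r →CP A)
    (hψ : ∀ x, ‖ψ x‖ ≤ ‖x‖) (hφ : ∀ y, ‖φ y‖ ≤ ‖y‖) (c : Fin s → Fin m)
    (horth : ∀ (j : Fin m) (x y : MatrixSum r),
      (∀ i, c i ≠ j → x i = 0) → (∀ i, c i ≠ j → y i = 0) →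
      0 ≤ x → 0 ≤ y → x * y = 0 → φ x * φ y = 0)
    {a : A} (ha : 0 ≤ a) (d : Fin m → A) (hd : ∀ j, 0 ≤ d j) (G : Fin m → Finset A)
    {ε η γ δ : ℝ} (hε : 0 ≤ ε) (hη : 0 < η) (hγ : 0 < γ) (hδ : 0 ≤ δ) (hδη : δ < η * γ)
    (hcmp : ∀ j, ∀ (n : ℕ) (ψ : A →ₗ[ℂ] CStarMatrix (Fin n) (Fin n) ℂ),
        (∀ x, 0 ≤ x → 0 ≤ ψ x) → (∀ x, ‖ψ x‖ ≤ ‖x‖) →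
        (∀ x, star (ψ x) * ψ x ≤ ψ (star x * x)) →
        (∀ b ∈ G j, ‖ψ (star b * b) - star (ψ b) * ψ b‖ ≤ η) →
        ∃ v : CStarMatrix (Fin n) (Fin n) ℂ, v * star v ≤ ψ a ∧ ψ a ≤ v * star v + (ε : ℂ) • 1 ∧
          (η : ℂ) • (v * star v) ≤ v * ψ (d j) * star v)
    (hφd : ∀ j, φ (ψ (d j)) ≤ d j + algebraMap ℝ A δ)
    (hφG : ∀ j, ∀ b ∈ G j, ‖φ (ψ (star b * b) - star (ψ b) * ψ b)‖ ≤ δ) :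
    ∃ z ∈ closure (Set.range fun v : Fin m → A => ∑ j, v j * d j * star (v j)),
      ‖φ (ψ a) - z‖ ≤ ε + ‖a‖ * (m * (δ / η)) + m * (2 * γ * ‖a‖) := by
  classical
  have hφ1 := φ.map_one_le_one hφ
  have hψ1 := ψ.map_one_le_one hψ
  set D : A → MatrixSum r := fun b => ψ (star b * b) - star (ψ b) * ψ b with hD
  have hD0 : ∀ b, 0 ≤ D b := fun b => sub_nonneg.2 (ψ.schwarz hψ1 b)
  set S : Fin m → Set (Fin s) := fun j => {i | c i = j} with hS
  -- A summand is tested only against the finite set of its own colour.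
  set bad : Set (Fin s) := {i | ∃ b ∈ G (c i), ¬ ‖D b i‖ ≤ η} with hbad
  have hgood : ∀ i, i ∉ bad → ∃ v : CStarMatrix (Fin (r i)) (Fin (r i)) ℂ,
      v * star v ≤ ψ a i ∧ ψ a i ≤ v * star v + (ε : ℂ) • 1 ∧
      (η : ℂ) • (v * star v) ≤ v * ψ (d (c i)) i * star v := by
    intro i hi
    refine hcmp (c i) (r i) ((LinearMap.proj i).comp ψ.toLinearMap) (fun x hx => ?_) (fun x => ?_)
      (fun x => ?_) (fun b hb => ?_)
    · exact map_nonneg ψ hx i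
    · exact (norm_le_pi_norm (ψ x) i).trans (hψ x)
    · exact ψ.schwarz hψ1 x i
    · by_contra h
      exact hi ⟨b, hb, h⟩
  choose! u hu1 hu2 hu3 using hgood
  set v : MatrixSum r := fun i => if i ∈ bad then 0 else u i with hv
  set p : Fin m → MatrixSum r := fun j => blockProj r (S j) with hp
  have hpp : ∀ j x, p j * (p j * x) = p j * x := fun j x => by
    rw [← mul_assoc, show p j * p j = p j from (isStarProjection_blockProj _).isIdempotentElem]
  have hpS : ∀ j (x : MatrixSum r), p j * x = x → ∀ i, c i ≠ j → x i = 0 := by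
    intro j x hx i hi
    rw [← hx, hp, blockProj_mul_apply, if_neg (by exact hi)]
  have hoz := fun j => φ.mul_eq_of_orthogonality_preserving (isStarProjection_blockProj (S j))
    (blockProj_comm (S j)) (fun x y hx hy => horth j x y (hpS j x hx) (hpS j y hy))
    (fun x hx => mem_span_projection_block hx)
  have happ : ∀ j (x : MatrixSum r) i, (p j * x) i = if c i = j then x i else 0 := fun j x i => by
    rw [hp, blockProj_mul_apply]; rfl
  have hψa1 : ∀ i, ψ a i ≤ (‖a‖ : ℂ) • 1 := fun i =>
    le_norm_smul_one (map_nonneg ψ ha i) ((norm_le_pi_norm (ψ a) i).trans (hψ a))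
  -- `v` vanishes on bad summands, so the required inequalities need checking only on the good
  -- summands of colour `j`; there `v v* ≤ ψ a ≤ ‖a‖` provides the constant `C = ‖a‖`.
  have hz : ∀ j, ∃ z ∈ closure (Set.range fun w : A => w * d j * star w),
      ‖φ (p j * v * star (p j * v)) - z‖ ≤ 2 * γ * ‖a‖ := by
    intro j
    refine φ.exists_mem_closure_norm_sub_le (isStarProjection_blockProj (S j))
      (blockProj_comm (S j)) (hoz j).1 (hoz j).2 (hpp j v) (hpp j (ψ (d j))) hγ hη hδ hδη
      (fun i => ?_) ((OrderHomClass.mono φ fun i => ?_).trans (hφd j)) (norm_nonneg a)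
      (fun i => ?_)
    · simp only [Pi.smul_apply, Pi.mul_apply _ (star _), Pi.mul_apply _ (p j * ψ (d j)),
        Pi.star_apply, happ]
      by_cases hij : c i = j
      · by_cases hib : i ∈ bad
        · simp [hv, hib]
        · have := hu3 i hib
          rw [hij] at this
          simpa [hv, hib, hij] using this
      · simp [hij]
    · rw [happ]
      split_ifs
      · exact le_rfl
      · exact map_nonneg ψ (hd j) i
    · simp only [Pi.smul_apply, Pi.mul_apply _ (star _), Pi.star_apply, happ, blockProj]
      by_cases hij : c i = j
      · have h0 : (0 : CStarMatrix (Fin (r i)) (Fin (r i)) ℂ) ≤ (‖a‖ : ℂ) • 1 :=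
          (map_nonneg ψ ha i).trans (hψa1 i)
        by_cases hib : i ∈ bad
        · simpa [hv, hib, hij, hS] using h0
        · simpa [hv, hib, hij, hS] using (hu1 i hib).trans (hψa1 i)
      · simp [hij, hS]
  choose z hzc hzn using hz
  refine ⟨∑ j, z j, sum_mem_closure_range hzc, ?_⟩
  have hvv : ∑ j, p j * v * star (p j * v) = v * star v := by
    funext i
    rw [Finset.sum_apply, Finset.sum_eq_single (c i)]
    · simp only [Pi.mul_apply _ (star _), Pi.star_apply, happ, if_true]
    · intro j _ hj
      simp [Pi.mul_apply _ (star _), happ, hj.symm]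
    · simp
  have hbp : ∑ j, blockProj r (bad ∩ S j) = blockProj r bad := by
    funext i
    rw [Finset.sum_apply, Finset.sum_eq_single (c i)]
    · simp [blockProj, hS]
    · intro j _ hj
      simp [blockProj, hS, hj.symm]
    · simp
  have hφb : ∀ j, ‖φ (blockProj r (bad ∩ S j))‖ ≤ δ / η := by
    intro j
    refine φ.norm_map_blockProj_le Set.inter_subset_right (hoz j).2 hη hδ ?_
    rintro i ⟨⟨b, hb, h⟩, -⟩
    exact ⟨D b, hD0 b, hφG _ b hb, h⟩
  have hlow : 0 ≤ ψ a - v * star v := by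
    intro i
    rw [Pi.zero_apply, Pi.sub_apply, Pi.mul_apply, Pi.star_apply, sub_nonneg]
    by_cases hib : i ∈ bad
    · simpa [hv, hib] using map_nonneg ψ ha i
    · simpa [hv, hib] using hu1 i hib
  -- On good summands the comparison loses at most `ε`; on bad ones `v = 0` and all of `ψ a` is
  -- lost, but `φ` of their unit has norm at most `m (δ / η)`.
  have hup : ψ a - v * star v ≤ (ε : ℂ) • 1 + (‖a‖ : ℂ) • blockProj r bad := by
    intro i
    rw [Pi.sub_apply, Pi.mul_apply, Pi.star_apply, sub_le_iff_le_add', Pi.add_apply, Pi.smul_apply,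
      Pi.smul_apply, blockProj, Pi.one_apply]
    by_cases hib : i ∈ bad
    · have h0 : (0 : CStarMatrix (Fin (r i)) (Fin (r i)) ℂ) ≤ (ε : ℂ) • 1 :=
        (norm_le_iff_le_smul_one le_rfl hε).1 (by simpa using hε)
      simpa [hv, hib] using (hψa1 i).trans (le_add_of_nonneg_left h0)
    · simpa [hv, hib] using hu2 i hib
  have h1 : ‖φ (ψ a - v * star v)‖ ≤ ε + ‖a‖ * (m * (δ / η)) := by
    refine (CStarAlgebra.norm_le_norm_of_nonneg_of_le (map_nonneg φ hlow)
      (OrderHomClass.mono φ hup)).trans ?_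
    rw [map_add, map_smul, map_smul, ← hbp, map_sum]
    refine (norm_add_le _ _).trans ?_
    rw [norm_smul, norm_smul, Complex.norm_real, Complex.norm_real, Real.norm_of_nonneg hε,
      norm_norm]
    have h2 : ‖φ 1‖ ≤ 1 := by
      refine (norm_le_iff_le_smul_one (map_nonneg φ zero_le_one) zero_le_one).2 ?_
      simpa using hφ1
    have h3 : ‖∑ j, φ (blockProj r (bad ∩ S j))‖ ≤ m * (δ / η) := by
      refine (norm_sum_le_of_le _ fun j _ => hφb j).trans ?_
      simp
    exact add_le_add (mul_le_of_le_one_right hε h2)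
      (mul_le_mul_of_nonneg_left h3 (norm_nonneg a))
  have h2 : ‖∑ j, (φ (p j * v * star (p j * v)) - z j)‖ ≤ m * (2 * γ * ‖a‖) := by
    refine (norm_sum_le_of_le _ fun j _ => hzn j).trans ?_
    simp
  have e : φ (ψ a) - ∑ j, z j =
      φ (ψ a - v * star v) + ∑ j, (φ (p j * v * star (p j * v)) - z j) := by
    rw [Finset.sum_sub_distrib, ← map_sum, hvv, map_sub]
    abel
  rw [e]
  exact (norm_add_le _ _).trans (add_le_add h1 h2)

theorem hasDecomposableApprox_of_decompositionRank_eq {n : ℕ} (h : decompositionRank A = n) :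
    HasDecomposableApprox A n := by
  have hne : {k : ℕ∞ | ∃ n : ℕ, k = n ∧ HasDecomposableApprox A n}.Nonempty := by
    rw [Set.nonempty_iff_ne_empty]
    intro h0
    rw [decompositionRank, h0, sInf_empty] at h
    exact ENat.top_ne_natCast n h
  obtain ⟨k, hk, hA⟩ := csInf_mem hne
  rw [← decompositionRank, h, Nat.cast_inj] at hk
  exact hk ▸ hA

/-- An approximate factorization through contractive completely positive maps is approximately
multiplicative in the sense that the image of the defect of `ψ` is small. -/
theorem norm_map_defect_le {F : Type*} [CStarAlgebra F] [PartialOrder F] [StarOrderedRing F]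
    (ψ : A →CP F) (φ : F →CP A) (hψ : ∀ x, ‖ψ x‖ ≤ ‖x‖) (hφ : ∀ y, ‖φ y‖ ≤ ‖y‖) {b : A} {δ : ℝ}
    (h1 : ‖φ (ψ b) - b‖ ≤ δ) (h2 : ‖φ (ψ (star b * b)) - star b * b‖ ≤ δ) :
    ‖φ (ψ (star b * b) - star (ψ b) * ψ b)‖ ≤ δ * (1 + 2 * ‖b‖) := by
  -- The Schwarz inequality for `φ` gives an upper bound close to `star b * b - star b * b = 0`, and
  -- the Schwarz inequality for `ψ` makes the left side positive.
  have hle : φ (ψ (star b * b) - star (ψ b) * ψ b) ≤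
      φ (ψ (star b * b)) - star (φ (ψ b)) * φ (ψ b) := by
    rw [map_sub]
    exact sub_le_sub_left (φ.schwarz (φ.map_one_le_one hφ) _) _
  refine (CStarAlgebra.norm_le_norm_of_nonneg_of_le
    (map_nonneg φ (sub_nonneg.2 (ψ.schwarz (ψ.map_one_le_one hψ) b))) hle).trans ?_
  have hb : ‖φ (ψ b)‖ ≤ ‖b‖ := (hφ _).trans (hψ b)
  have e : φ (ψ (star b * b)) - star (φ (ψ b)) * φ (ψ b) =
      (φ (ψ (star b * b)) - star b * b) - (star (φ (ψ b)) * (φ (ψ b) - b) +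
        star (φ (ψ b) - b) * b) := by
    rw [star_sub]; noncomm_ring
  rw [e]
  refine (norm_sub_le _ _).trans ?_
  have h3 : ‖star (φ (ψ b)) * (φ (ψ b) - b)‖ ≤ ‖b‖ * δ :=
    (norm_mul_le _ _).trans (by rw [norm_star]; gcongr)
  have h4 : ‖star (φ (ψ b) - b) * b‖ ≤ δ * ‖b‖ :=
    (norm_mul_le _ _).trans (by rw [norm_star]; gcongr)
  have h5 := norm_add_le (star (φ (ψ b)) * (φ (ψ b) - b)) (star (φ (ψ b) - b) * b)
  linarith

theorem le_add_algebraMap_of_norm_sub_le {x y : A} (hx : IsSelfAdjoint x) (hy : IsSelfAdjoint y)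
    {δ : ℝ} (h : ‖x - y‖ ≤ δ) : x ≤ y + algebraMap ℝ A δ := by
  rw [← sub_le_iff_le_add']
  exact (hx.sub hy).le_algebraMap_norm_self.trans (algebraMap_mono A h)

end

theorem mainTheorem4 (A : Type*) [CStarAlgebra A] [PartialOrder A] [StarOrderedRing A]
    [TopologicalSpace.SeparableSpace A] (hsimple : IsSimpleCStarAlgebra A)
    (n : ℕ) (hdr : decompositionRank A = n)
    (a : A) (ha : 0 ≤ a) (d : Fin (n + 1) → A) (hd : ∀ i, 0 ≤ d i)
    (hlt : ∀ (i : Fin (n + 1)) (τ : TracialState A), τ.dimFun a < τ.dimFun (d i)) :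
    CuntzSemigroup.ofPos a ha ≤ ∑ i, CuntzSemigroup.ofPos (d i) (hd i) := by
  classical
  have hA : Nontrivial A := hsimple.1
  have happrox := hasDecomposableApprox_of_decompositionRank_eq hdr
  refine CuntzSemigroup.ofPos_le_sum_ofPos ha hd ?_
  -- The approximants to be produced are themselves only limits of sums `∑ i, v i * d i * star (v
  -- i)`.
  rw [← closure_closure, Metric.mem_closure_iff]
  intro κ hκ
  -- Four errors of at most `ε` occur: eigenvalue truncation, bad summands, cutting by `ramp γ`, and
  -- `‖φ (ψ a) - a‖`.
  set ε := κ / 5 with hε_def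
  have hε : 0 < ε := by positivity
  choose G η₀ hη₀ hcmp using fun j => exists_finset_comparison ha (hd j) (hlt j) hε
  set η := Finset.univ.inf' Finset.univ_nonempty η₀ with hη_def
  have hη : 0 < η := by
    rw [hη_def, Finset.lt_inf'_iff]
    exact fun j _ => hη₀ j
  have hηle : ∀ j, η ≤ η₀ j := fun j => Finset.inf'_le _ (Finset.mem_univ j)
  -- This makes the total error of cutting by `ramp γ` over all `n + 1` colours at most `ε`; `‖a‖ +
  -- 1` avoids division by zero.
  set γ := ε / (2 * (n + 1) * (‖a‖ + 1)) with hγ_def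
  have hγ : 0 < γ := by positivity
  -- The first bound gives the strict `δ < η γ` needed for comparison in `A`, the second makes the
  -- contribution of the bad summands at most `ε`.
  set δ := min (η * γ / 2) (ε * η / ((n + 1) * (‖a‖ + 1))) with hδ_def
  have hδ : 0 < δ := by positivity
  have hδη : δ < η * γ := by
    have : 0 < η * γ := by positivity
    exact (min_le_left _ _).trans_lt (by linarith)
  set T : Finset A := Finset.univ.biUnion G with hT_def
  obtain ⟨M, hM0, hM⟩ : ∃ M : ℝ, 0 ≤ M ∧ ∀ b ∈ T, ‖b‖ ≤ M :=
    ⟨∑ b ∈ T, ‖b‖, Finset.sum_nonneg fun _ _ => norm_nonneg _, fun b hb =>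
      Finset.single_le_sum (f := fun b => ‖b‖) (fun _ _ => norm_nonneg _) hb⟩
  -- The factor `1 + 2 * M` is the loss in `norm_map_defect_le`, uniformly over all test elements.
  set δ₀ := min ε (δ / (1 + 2 * M)) with hδ₀_def
  have hδ₀ : 0 < δ₀ := by positivity
  have hδ₀M : δ₀ * (1 + 2 * M) ≤ δ := by
    rw [← le_div_iff₀ (by positivity)]
    exact min_le_right _ _
  have hδ₀δ : δ₀ ≤ δ := le_trans (le_mul_of_one_le_right hδ₀.le (by linarith)) hδ₀M
  obtain ⟨s, r, ψ, φ, -, hψ, hφ, happ, c, hc⟩ := happrox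
    (insert a (Finset.univ.image d ∪ (T ∪ T.image fun b => star b * b))) δ₀ hδ₀
  have hT : ∀ j, ∀ b ∈ G j, b ∈ T := fun j b hb =>
    Finset.mem_biUnion.2 ⟨j, Finset.mem_univ j, hb⟩
  obtain ⟨z, hz, hza⟩ := exists_mem_closure_sum_conj ψ φ hψ hφ c hc ha d hd G hε.le hη hγ hδ.le hδη
    (fun j k χ h1 h2 h3 h4 => by
      obtain ⟨v, hv1, hv2, hv3⟩ := hcmp j k χ h1 h2 h3 fun b hb => (h4 b hb).trans (hηle j)
      refine ⟨v, hv1, hv2, le_trans ?_ hv3⟩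
      exact ofReal_smul_mono (mul_star_self_nonneg v) (hηle j))
    (fun j => le_add_algebraMap_of_norm_sub_le (map_nonneg φ (map_nonneg ψ (hd j))).isSelfAdjoint
      (hd j).isSelfAdjoint ((happ _ (by simp)).le.trans hδ₀δ))
    (fun j b hb => (norm_map_defect_le ψ φ hψ hφ (happ b (by simp [hT j b hb])).le
      (happ _ (Finset.mem_insert_of_mem (Finset.mem_union_right _ (Finset.mem_union_right _
        (Finset.mem_image_of_mem _ (hT j b hb)))))).le).trans
      (le_trans (by gcongr; exact hM b (hT j b hb)) hδ₀M))
  refine ⟨z, hz, ?_⟩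
  have h1 : ‖φ (ψ a) - a‖ < ε := (happ a (by simp)).trans_le (min_le_left _ _)
  have h2 : ‖a‖ * (((n + 1 : ℕ) : ℝ) * (δ / η)) ≤ ε := by
    have : δ / η ≤ ε / ((n + 1) * (‖a‖ + 1)) := by
      rw [div_le_iff₀ hη, div_mul_eq_mul_div]
      exact min_le_right _ _
    calc ‖a‖ * (((n + 1 : ℕ) : ℝ) * (δ / η))
        ≤ (‖a‖ + 1) * (((n + 1 : ℕ) : ℝ) * (ε / ((n + 1) * (‖a‖ + 1)))) := by
          gcongr; linarith
      _ = ε := by push_cast; field_simp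
  have h3 : ((n + 1 : ℕ) : ℝ) * (2 * γ * ‖a‖) ≤ ε := by
    calc ((n + 1 : ℕ) : ℝ) * (2 * γ * ‖a‖) ≤ ((n + 1 : ℕ) : ℝ) * (2 * γ * (‖a‖ + 1)) := by
          gcongr; linarith
      _ = ε := by rw [hγ_def]; push_cast; field_simp
  rw [dist_eq_norm]
  calc ‖a - z‖ = ‖(φ (ψ a) - z) - (φ (ψ a) - a)‖ := by congr 1; abel
    _ ≤ ‖φ (ψ a) - z‖ + ‖φ (ψ a) - a‖ := norm_sub_le _ _
    _ < κ := by linarith
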